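/- Let $0<\alpha_1\le\alpha_2<1$ and $\beta_1,\beta_2>0$. For $\alpha\in(0,1)$, $\kappa,\beta>0$ let $E_{\alpha,\kappa}(x)=\sum_{k\ge 0}\frac{x^k}{\Gamma(\kappa+k\alpha)}$ be the Mittag-Leffler function and $f^{\alpha,\beta}(t)=\beta t^{\alpha-1}E_{\alpha,\alpha}(-\beta t^{\alpha})$, $t>0$, the Mittag-Leffler density. Consider a Hawkes process whose kernel is $\phi=f^{\alpha_1,\beta_1}*f^{\alpha_2,\beta_2}$, where $(f*g)(t)=\int_0^t f(t-s)g(s)\,ds$. Then the resolvent equation $$R(t)=\phi(t)+(R*\phi)(t)\qquad\text{for almost every } t\ge 0$$ has a solution $R\in L^1_{\rm loc}([0,\infty))$. For every such solution (the resolvent of $\phi$) put $\mathcal I_R(t)=\int_0^t R(s)\,ds$ and $\mathcal I_R^2(t)=\int_0^t\mathcal I_R(s)\,ds$ (the second repeated integral, not the square), $t\ge 0$. A measurable $F:[0,\infty)\to\mathbb R$ is in ${\rm RV}^\infty_\alpha$ if it has constant (nonzero) sign near infinity and $F(tx)/F(t)\to x^\alpha$ as $t\to\infty$ for every $x>0$;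 and $F\in{\rm 2RV}^\infty_{\alpha,\rho}(A)$ if $F\in{\rm RV}^\infty_\alpha$, $A$ is eventually positive or eventually negative, and $$\lim_{t\to\infty}\frac{F(tx)/F(t)-x^\alpha}{A(t)}=x^\alpha\int_1^x u^{\rho-1}\,du,\qquad x>0.$$ Then $$\mathcal I_R\in{\rm 2RV}^\infty_{\alpha_1,\rho_\alpha}(A_{\rm HP})\quad\text{and}\quad \mathcal I_R^2\in{\rm 2RV}^\infty_{\alpha_1+1,\rho_\alpha}\Big(\frac{\alpha_1+1}{\alpha_1+\rho_\alpha+1}\cdot A_{\rm HP}\Big),$$ where $$\rho_\alpha=\begin{cases}-\alpha_1,&\alpha_1=\alpha_2,\\ \alpha_1-\alpha_2,&\alpha_1<\alpha_2,\end{cases}\qquad A_{\rm HP}(t)=\begin{cases}\dfrac{\alpha_1\Gamma(1+\alpha_1)}{\beta_1+\beta_2}\,t^{-\alpha_1},&\alpha_1=\alpha_2,\\[2mm] (\alpha_2-\alpha_1)\dfrac{\beta_1\Gamma(1+\alpha_1)}{\beta_2\Gamma(1+2\alpha_1-\alpha_2)}\,t^{\alpha_1-\alpha_2},&\alpha_1<\alpha_2.\end{cases}$$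 -/

import Mathlib

open Filter Set MeasureTheory

noncomputable section

/-- `F` is regularly varying at infinity with index `α`: `F` is measurable on `[0, ∞)`, has constant
sign near infinity, and `F (t x) / F t → x ^ α` as `t → ∞` for every `x > 0`. -/
def RegVarAtInfinity (α : ℝ) (F : ℝ → ℝ) : Prop :=
  Measurable (fun t : Ici (0 : ℝ) => F t) ∧
  ((∀ᶠ t in atTop, 0 < F t) ∨ (∀ᶠ t in atTop, F t < 0)) ∧
  ∀ x : ℝ, 0 < x → Tendsto (fun t : ℝ => F (t * x) / F t) atTop (nhds (x ^ α))

/-- `F` is of second-order regular variation at infinity with first-order parameter `α`,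
second-order parameter `ρ` and auxiliary function `A`. -/
def SecondOrderRegVarAtInfinity (α ρ : ℝ) (A F : ℝ → ℝ) : Prop :=
  RegVarAtInfinity α F ∧
  ((∀ᶠ t in atTop, 0 < A t) ∨ (∀ᶠ t in atTop, A t < 0)) ∧
  ∀ x : ℝ, 0 < x →
    Tendsto (fun t : ℝ => (F (t * x) / F t - x ^ α) / A t) atTop
      (nhds (x ^ α * ∫ u in (1 : ℝ)..x, u ^ (ρ - 1)))

/-- The two-parameter Mittag-Leffler function `E_{α,κ}`. -/
def mittagLeffler (α κ : ℝ) (t : ℝ) : ℝ :=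
  ∑' k : ℕ, t ^ k / Real.Gamma (κ + k * α)

/-- The Mittag-Leffler density `f^{α,β}` on the positive half-line. -/
def mittagLefflerDensity (α β : ℝ) (t : ℝ) : ℝ :=
  β * t ^ (α - 1) * mittagLeffler α α (-β * t ^ α)

/-- The convolution on the half-line, `(f * g)(t) = ∫_0^t f (t - s) g s ds`. -/
def halfLineConv (f g : ℝ → ℝ) (t : ℝ) : ℝ :=
  ∫ s in (0 : ℝ)..t, f (t - s) * g s

/-- The mixed Mittag-Leffler kernel, the convolution of two Mittag-Leffler densities. -/
def mixedMittagLefflerKernel (α₁ β₁ α₂ β₂ : ℝ) : ℝ → ℝ :=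
  halfLineConv (mittagLefflerDensity α₁ β₁) (mittagLefflerDensity α₂ β₂)

/-- `R` is a resolvent of the kernel `φ`: it is locally integrable on `[0, ∞)` and solves
`R = φ + R * φ` there. Elements of `L¹_loc` are only determined up to null sets, so the equation
is required almost everywhere. -/
def IsResolventOf (φ R : ℝ → ℝ) : Prop :=
  LocallyIntegrableOn R (Ici (0 : ℝ)) volume ∧
  ∀ᵐ t ∂(volume.restrict (Ici (0 : ℝ))), R t = φ t + halfLineConv R φ t

/-- The integral function `I_f (t) = ∫_0^t f s ds`. -/
def integralFromZero (f : ℝ → ℝ) (t : ℝ) : ℝ :=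
  ∫ s in (0 : ℝ)..t, f s

/-- The second-order parameter `ρ_α`. -/
def rhoHP (α₁ α₂ : ℝ) : ℝ :=
  if α₁ = α₂ then -α₁ else α₁ - α₂

/-- The auxiliary function `A_HP`. -/
def auxHP (α₁ β₁ α₂ β₂ : ℝ) (t : ℝ) : ℝ :=
  if α₁ = α₂ then
    α₁ * Real.Gamma (1 + α₁) / (β₁ + β₂) * t ^ (-α₁)
  else
    (α₂ - α₁) * (β₁ * Real.Gamma (1 + α₁) / (β₂ * Real.Gamma (1 + 2 * α₁ - α₂))) *
      t ^ (α₁ - α₂)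

end

/-! Everything is read off Laplace transforms. Put `x = β₁ s^(-α₁)` and `y = β₂ s^(-α₂)`. The two
densities have transforms `x/(1+x)` and `y/(1+y)`, so since `(1+x)(1+y) - xy = 1+x+y`, a resolvent
of `φ` must have transform `xy/(1+x+y)`. The same denominator occurs for the simpler kernel `k = β₁
g_{α₁} + β₂ g_{α₂}`, where `g_c(t) = t^(c-1)/Γ(c)` has transform `s^(-c)`: its resolvent `r`, with
`r + k * r = k`, has transform `(x+y)/(1+x+y)`. Hence `R = β₁β₂ (g_{α₁+α₂} - g_{α₁+α₂} * r)`.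

The key object is `S = 1 - ∫₀ r`, with transform `s⁻¹/(1+x+y)`. If `r > 0`, then `S` is
nonincreasing with values in `[0, 1]`, and Karamata's Tauberian theorem turns the behaviour of its
transform at `s → 0` into `S(t) ~ C t^(-α₂)`. Positivity of `r` holds because `k` is positive,
nonincreasing and log-convex (`pos_of_add_halfLineConv_eq`).

No expansion of `R` itself is needed. The `m`-fold integral of `R` is exactly a power minus
fractional integrals of `S`. For `α₁ < α₂` this is the identity `xy/(1+x+y) = x - x(1+x)/(1+x+y)`;
for `α₁ = α₂` it is `xy/(1+x+y) = (β₁β₂/(β₁+β₂)) s^(-α₁) (1 - 1/(1+x+y))`. Fractional integration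
preserves power asymptotics (`tendsto_rpow_mul_halfLineConv_fracKernel`), so the integral equals `c
(t^p - Q(t))` with `Q(t) ~ d t^(p+ρ)`, and second-order regular variation is then elementary.

The functions `r` and `φ` are first known as series whose transforms converge only for large `s`.
This suffices to identify them, a function being determined by its transform near infinity. The
bound `0 < r ≤ k` then extends the transform of `r` to all `s > 0`. -/

/-! ### Laplace transforms on the half-line. -/

/-- The fractional integration kernel `g_c (t) = t ^ (c - 1) / Γ(c)`. -/
noncomputable def fracKernel (c t : ℝ) : ℝ := t ^ (c - 1) / Real.Gamma c

/-- `f` is integrable on the positive half-line against the weight `e ^ (-σ t)`. -/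
def LaplaceIntegrable (σ : ℝ) (f : ℝ → ℝ) : Prop :=
  IntegrableOn (fun t => Real.exp (-(σ * t)) * f t) (Ioi 0)

/-- The Laplace transform on the half-line. -/
noncomputable def laplace (f : ℝ → ℝ) (s : ℝ) : ℝ :=
  ∫ t in Ioi (0 : ℝ), Real.exp (-(s * t)) * f t

namespace LaplaceIntegrable

variable {σ s : ℝ} {f g : ℝ → ℝ}

theorem aestronglyMeasurable (hf : LaplaceIntegrable σ f) :
    AEStronglyMeasurable f (volume.restrict (Ioi 0)) := by
  have h1 : AEStronglyMeasurable (fun t => Real.exp (σ * t) * (Real.exp (-(σ * t)) * f t))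
      (volume.restrict (Ioi 0)) :=
    (by fun_prop : Continuous fun t : ℝ => Real.exp (σ * t)).aestronglyMeasurable.mul
      (Integrable.aestronglyMeasurable hf)
  refine h1.congr (Eventually.of_forall fun t => ?_)
  simp only
  rw [← mul_assoc, ← Real.exp_add]
  simp

theorem of_le_of_norm_le (hg : LaplaceIntegrable σ g) (hσ : σ ≤ s)
    (hf : AEStronglyMeasurable f (volume.restrict (Ioi 0)))
    (hfg : ∀ t, 0 < t → |f t| ≤ g t) : LaplaceIntegrable s f := by
  refine Integrable.mono' hg ((by fun_prop : Continuous fun t : ℝ =>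
    Real.exp (-(s * t))).aestronglyMeasurable.mul hf) ?_
  filter_upwards [ae_restrict_mem measurableSet_Ioi] with t ht
  have ht : 0 < t := ht
  rw [norm_mul, Real.norm_eq_abs, Real.norm_eq_abs, Real.abs_exp]
  gcongr
  exact hfg t ht

theorem abs (hf : LaplaceIntegrable σ f) : LaplaceIntegrable σ (fun t => |f t|) := by
  refine (Integrable.abs hf).congr (Eventually.of_forall fun t => ?_)
  simp [abs_mul]

theorem mono (hf : LaplaceIntegrable σ f) (h : σ ≤ s) : LaplaceIntegrable s f :=
  hf.abs.of_le_of_norm_le h hf.aestronglyMeasurable fun _ _ => le_rfl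

theorem congr (hf : LaplaceIntegrable σ f) (h : ∀ᵐ t ∂volume.restrict (Ioi 0), f t = g t) :
    LaplaceIntegrable σ g := by
  refine Integrable.congr hf ?_
  filter_upwards [h] with t ht
  rw [ht]

theorem add (hf : LaplaceIntegrable σ f) (hg : LaplaceIntegrable σ g) :
    LaplaceIntegrable σ (fun t => f t + g t) := by
  refine (Integrable.add hf hg).congr (Eventually.of_forall fun t => ?_)
  simp [mul_add]

theorem sub (hf : LaplaceIntegrable σ f) (hg : LaplaceIntegrable σ g) :
    LaplaceIntegrable σ (fun t => f t - g t) := by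
  refine (Integrable.sub hf hg).congr (Eventually.of_forall fun t => ?_)
  simp [mul_sub]

theorem const_mul (hf : LaplaceIntegrable σ f) (c : ℝ) :
    LaplaceIntegrable σ (fun t => c * f t) := by
  refine (Integrable.const_mul hf c).congr (Eventually.of_forall fun t => ?_)
  simp only
  ring

theorem integrableOn_Ioc (hf : LaplaceIntegrable σ f) (T : ℝ) : IntegrableOn f (Ioc 0 T) := by
  -- The constant `e^(|σ| T)` undoes the weight on `(0, T]` whatever the sign of `σ`.
  have h1 : IntegrableOn (fun t => Real.exp (|σ| * T) * (Real.exp (-(σ * t)) * f t)) (Ioc 0 T) :=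
    (hf.mono_set Ioc_subset_Ioi_self).const_mul _
  refine Integrable.mono h1 (hf.aestronglyMeasurable.mono_set Ioc_subset_Ioi_self) ?_
  filter_upwards [ae_restrict_mem measurableSet_Ioc] with t ht
  rw [norm_mul, norm_mul, ← mul_assoc, Real.norm_of_nonneg (Real.exp_pos _).le,
    Real.norm_of_nonneg (Real.exp_pos _).le, ← Real.exp_add]
  refine le_mul_of_one_le_left (norm_nonneg _) (Real.one_le_exp ?_)
  have h2 : σ * t ≤ |σ| * T :=
    mul_le_mul (le_abs_self σ) ht.2 ht.1.le (abs_nonneg σ)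
  linarith

theorem intervalIntegrable (hf : LaplaceIntegrable σ f) (T : ℝ) (hT : 0 ≤ T) :
    IntervalIntegrable f volume 0 T :=
  (intervalIntegrable_iff_integrableOn_Ioc_of_le hT).2 (hf.integrableOn_Ioc T)

theorem locallyIntegrableOn (hf : LaplaceIntegrable σ f) :
    LocallyIntegrableOn f (Ici (0 : ℝ)) := by
  rw [locallyIntegrableOn_iff isClosed_Ici.isLocallyClosed]
  intro K hK hKc
  obtain ⟨T, hT⟩ := hKc.bddAbove
  refine IntegrableOn.mono_set (t := Icc 0 T) ?_ fun x hx => ⟨hK hx, hT hx⟩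
  exact (integrableOn_Icc_iff_integrableOn_Ioc).2 (hf.integrableOn_Ioc T)

end LaplaceIntegrable

section LaplaceTransform

variable {σ s : ℝ} {f g : ℝ → ℝ}

theorem laplace_congr (h : ∀ᵐ t ∂volume.restrict (Ioi 0), f t = g t) (s : ℝ) :
    laplace f s = laplace g s := by
  refine integral_congr_ae ?_
  filter_upwards [h] with t ht
  rw [ht]

theorem laplace_add (hf : LaplaceIntegrable s f) (hg : LaplaceIntegrable s g) :
    laplace (fun t => f t + g t) s = laplace f s + laplace g s := by
  rw [laplace, laplace, laplace, ← integral_add hf hg]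
  simp only [mul_add]

theorem laplace_sub (hf : LaplaceIntegrable s f) (hg : LaplaceIntegrable s g) :
    laplace (fun t => f t - g t) s = laplace f s - laplace g s := by
  rw [laplace, laplace, laplace, ← integral_sub hf hg]
  simp only [mul_sub]

theorem laplace_const_mul (c : ℝ) (f : ℝ → ℝ) (s : ℝ) :
    laplace (fun t => c * f t) s = c * laplace f s := by
  rw [laplace, laplace, ← integral_const_mul]
  simp only [mul_left_comm]

/-- The weight is multiplicative, `e^(-sx) = e^(-st) e^(-s(x-t))`, so it passes inside. The factors
are swapped to match `posConvolution`, whose Fubini theorem then gives the product rule for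
transforms. -/
theorem exp_mul_halfLineConv (s : ℝ) (f g : ℝ → ℝ) (x : ℝ) :
    Real.exp (-(s * x)) * halfLineConv f g x =
      ∫ t in (0 : ℝ)..x, ContinuousLinearMap.mul ℝ ℝ (Real.exp (-(s * t)) * g t)
        (Real.exp (-(s * (x - t))) * f (x - t)) := by
  rw [halfLineConv, ← intervalIntegral.integral_const_mul]
  refine intervalIntegral.integral_congr fun t _ => ?_
  have h : Real.exp (-(s * x)) = Real.exp (-(s * t)) * Real.exp (-(s * (x - t))) := by
    rw [← Real.exp_add]
    ring_nf
  simp only [ContinuousLinearMap.mul_apply', h]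
  ring

theorem LaplaceIntegrable.halfLineConv (hf : LaplaceIntegrable s f)
    (hg : LaplaceIntegrable s g) : LaplaceIntegrable s (halfLineConv f g) := by
  refine (integrable_posConvolution hg hf (ContinuousLinearMap.mul ℝ ℝ)).integrableOn.congr_fun
    (fun x hx => ?_) measurableSet_Ioi
  rw [posConvolution, indicator_of_mem hx, exp_mul_halfLineConv]

theorem laplace_halfLineConv (hf : LaplaceIntegrable s f) (hg : LaplaceIntegrable s g) :
    laplace (halfLineConv f g) s = laplace f s * laplace g s := by
  rw [laplace]
  simp only [exp_mul_halfLineConv]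
  rw [integral_posConvolution hg hf (ContinuousLinearMap.mul ℝ ℝ)]
  simp only [ContinuousLinearMap.mul_apply']
  rw [mul_comm]
  rfl

theorem fracKernel_pos {c t : ℝ} (hc : 0 < c) (ht : 0 < t) : 0 < fracKernel c t :=
  div_pos (Real.rpow_pos_of_pos ht _) (Real.Gamma_pos_of_pos hc)

theorem continuousOn_fracKernel (c : ℝ) : ContinuousOn (fracKernel c) (Ioi 0) :=
  fun t ht => ((Real.continuousAt_rpow_const t (c - 1)
    (Or.inl (ne_of_gt ht))).div_const _).continuousWithinAt

theorem fracKernel_one : fracKernel 1 = fun _ => 1 := by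
  ext t
  simp [fracKernel]

theorem laplaceIntegrable_fracKernel {c : ℝ} (hc : 0 < c) (hs : 0 < s) :
    LaplaceIntegrable s (fracKernel c) := by
  have h := integrableOn_rpow_mul_exp_neg_mul_rpow (s := c - 1) (p := 1) (by linarith) one_pos hs
  refine (h.div_const (Real.Gamma c)).congr (Eventually.of_forall fun t => ?_)
  simp only [Real.rpow_one, fracKernel, neg_mul]
  ring

theorem laplace_fracKernel {c : ℝ} (hc : 0 < c) (hs : 0 < s) :
    laplace (fracKernel c) s = s ^ (-c) := by
  have h := Real.integral_rpow_mul_exp_neg_mul_Ioi hc hs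
  have h2 : laplace (fracKernel c) s =
      (∫ t in Ioi (0 : ℝ), t ^ (c - 1) * Real.exp (-(s * t))) / Real.Gamma c := by
    rw [laplace, ← integral_div]
    refine integral_congr_ae (Eventually.of_forall fun t => ?_)
    simp only [fracKernel]
    ring
  rw [h2, h, mul_div_assoc, div_self (Real.Gamma_pos_of_pos hc).ne', mul_one, one_div,
    Real.inv_rpow hs.le, Real.rpow_neg hs.le]

theorem laplaceIntegrable_one (hs : 0 < s) : LaplaceIntegrable s (fun _ => 1) := by
  simpa [fracKernel_one] using laplaceIntegrable_fracKernel one_pos hs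

theorem laplace_one (hs : 0 < s) : laplace (fun _ => 1) s = s⁻¹ := by
  simpa [fracKernel_one, Real.rpow_neg_one] using laplace_fracKernel one_pos hs

theorem integralFromZero_eq_halfLineConv (f : ℝ → ℝ) :
    integralFromZero f = halfLineConv (fun _ => 1) f := by
  ext t
  simp [integralFromZero, halfLineConv]

theorem LaplaceIntegrable.integralFromZero (hf : LaplaceIntegrable s f) (hs : 0 < s) :
    LaplaceIntegrable s (integralFromZero f) := by
  rw [integralFromZero_eq_halfLineConv]
  exact (laplaceIntegrable_one hs).halfLineConv hf

theorem laplace_integralFromZero (hf : LaplaceIntegrable s f) (hs : 0 < s) :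
    laplace (integralFromZero f) s = s⁻¹ * laplace f s := by
  rw [integralFromZero_eq_halfLineConv, laplace_halfLineConv (laplaceIntegrable_one hs) hf,
    laplace_one hs]

end LaplaceTransform

/-! ### Moments in `e^(-t)` and uniqueness of Laplace transforms. -/

theorem Continuous.integrableOn_comp_exp_neg_mul {h F : ℝ → ℝ} (hh : Continuous h)
    (hF : IntegrableOn F (Ioi 0)) :
    IntegrableOn (fun t => h (Real.exp (-t)) * F t) (Ioi 0) := by
  obtain ⟨C, hC⟩ := isCompact_Icc.exists_bound_of_continuousOn (s := Icc (0 : ℝ) 1)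
    hh.continuousOn
  refine Integrable.bdd_mul (c := C) hF
    (by fun_prop : Continuous fun t : ℝ => h (Real.exp (-t))).aestronglyMeasurable ?_
  filter_upwards [ae_restrict_mem measurableSet_Ioi] with t ht
  exact hC _ ⟨(Real.exp_pos _).le, Real.exp_le_one_iff.2 (neg_nonpos.2 (le_of_lt ht))⟩

/-- Convergence of the moments in `e ^ (-t)` of an `L¹`-bounded family yields convergence of the
integrals against every continuous function of `e ^ (-t)`. -/
theorem tendsto_integral_comp_exp_neg_mul {ι : Type*} {l : Filter ι} {F : ι → ℝ → ℝ} {G : ℝ → ℝ}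
    (hF : ∀ᶠ i in l, IntegrableOn (F i) (Ioi 0)) (hG : IntegrableOn G (Ioi 0)) {M : ℝ}
    (hM : ∀ᶠ i in l, ∫ t in Ioi 0, |F i t| ≤ M)
    (hmom : ∀ k : ℕ, Tendsto (fun i => ∫ t in Ioi 0, Real.exp (-t) ^ k * F i t) l
      (nhds (∫ t in Ioi 0, Real.exp (-t) ^ k * G t)))
    {h : ℝ → ℝ} (hh : Continuous h) :
    Tendsto (fun i => ∫ t in Ioi 0, h (Real.exp (-t)) * F i t) l
      (nhds (∫ t in Ioi 0, h (Real.exp (-t)) * G t)) := by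
  have hpoly : ∀ p : Polynomial ℝ,
      Tendsto (fun i => ∫ t in Ioi 0, p.eval (Real.exp (-t)) * F i t) l
        (nhds (∫ t in Ioi 0, p.eval (Real.exp (-t)) * G t)) := by
    intro p
    induction p using Polynomial.induction_on' with
    | add p q hp hq =>
      have hadd : ∀ H : ℝ → ℝ, IntegrableOn H (Ioi 0) →
          ∫ t in Ioi 0, (p + q).eval (Real.exp (-t)) * H t =
          (∫ t in Ioi 0, p.eval (Real.exp (-t)) * H t) +
            ∫ t in Ioi 0, q.eval (Real.exp (-t)) * H t := by
        intro H hH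
        rw [← integral_add (p.continuous.integrableOn_comp_exp_neg_mul hH)
          (q.continuous.integrableOn_comp_exp_neg_mul hH)]
        simp only [Polynomial.eval_add, add_mul]
      rw [hadd G hG]
      refine (hp.add hq).congr' ?_
      filter_upwards [hF] with i hi
      exact (hadd _ hi).symm
    | monomial n a =>
      simp only [Polynomial.eval_monomial, mul_assoc, integral_const_mul]
      exact (hmom n).const_mul a
  rw [Metric.tendsto_nhds]
  intro ε hε
  have hG0 : 0 ≤ ∫ t in Ioi 0, |G t| := integral_nonneg fun _ => abs_nonneg _
  have hK : 0 < |M| + (∫ t in Ioi 0, |G t|) + 1 := by positivity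
  set K := |M| + (∫ t in Ioi 0, |G t|) + 1
  -- Weierstrass approximation on `[0, 1]`, where `e^(-t)` lives. `K` bounds the `L¹` norms of `G`
  -- and eventually of all `F i`, so replacing `h` by `p` costs at most `ε/3` on each side.
  obtain ⟨p, hp⟩ := exists_polynomial_near_of_continuousOn 0 1 h hh.continuousOn (ε / (3 * K))
    (by positivity)
  have herr : ∀ H : ℝ → ℝ, IntegrableOn H (Ioi 0) → (∫ t in Ioi 0, |H t|) ≤ K →
      |(∫ t in Ioi 0, p.eval (Real.exp (-t)) * H t) - ∫ t in Ioi 0, h (Real.exp (-t)) * H t|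
        ≤ ε / 3 := by
    intro H hH hHK
    rw [← integral_sub (p.continuous.integrableOn_comp_exp_neg_mul hH)
      (hh.integrableOn_comp_exp_neg_mul hH), ← Real.norm_eq_abs]
    calc _ ≤ ∫ t in Ioi 0, ε / (3 * K) * |H t| := by
          refine norm_integral_le_of_norm_le (hH.abs.const_mul _) ?_
          filter_upwards [ae_restrict_mem measurableSet_Ioi] with t ht
          rw [← sub_mul, norm_mul, Real.norm_eq_abs, Real.norm_eq_abs]
          gcongr
          exact (hp _ ⟨(Real.exp_pos _).le,
            Real.exp_le_one_iff.2 (neg_nonpos.2 (le_of_lt ht))⟩).le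
      _ ≤ ε / (3 * K) * K := by
          rw [integral_const_mul]
          gcongr
      _ = ε / 3 := by field_simp
  filter_upwards [hF, hM, Metric.tendsto_nhds.1 (hpoly p) (ε / 3) (by positivity)] with i h1 h2 h3
  have e1 := abs_le.1 (herr _ h1 (h2.trans (by
    simp only [K]
    linarith [le_abs_self M])))
  have e2 := abs_le.1 (herr _ hG (by
    simp only [K]
    linarith [abs_nonneg M]))
  rw [Real.dist_eq, abs_lt] at h3 ⊢
  constructor <;> linarith [e1.1, e1.2, e2.1, e2.2, h3.1, h3.2]

theorem exp_neg_pow_mul_exp (σ t : ℝ) (k : ℕ) :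
    Real.exp (-t) ^ k * Real.exp (-(σ * t)) = Real.exp (-((k + σ) * t)) := by
  rw [← Real.exp_nat_mul, ← Real.exp_add]
  ring_nf

/-- A continuous function with compact support in `(0, ∞)` is a continuous function of
`e ^ (-t)`. -/
theorem continuous_comp_neg_log {ψ : ℝ → ℝ} (hψ : Continuous ψ) (hc : HasCompactSupport ψ)
    (h0 : ψ 0 = 0) : Continuous fun x => ψ (-Real.log x) := by
  rw [continuous_iff_continuousAt]
  intro x
  rcases eq_or_ne x 0 with rfl | hx
  -- Near `x = 0` the argument `-log x` leaves the support. At `x = 0` itself `Real.log 0 = 0`, so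
  -- the value is `ψ 0`, which is why `ψ 0 = 0` is required.
  · have h1 : ∀ᶠ t in atTop, ψ t = 0 := by
      obtain ⟨T, hT⟩ := hc.isCompact.bddAbove
      filter_upwards [eventually_gt_atTop T] with t ht
      by_contra hne
      exact absurd (hT (subset_tsupport ψ hne)) (not_le.2 ht)
    have h2 : Tendsto (fun x => -Real.log x) (nhdsWithin 0 {0}ᶜ) atTop :=
      tendsto_neg_atBot_atTop.comp Real.tendsto_log_nhdsNE_zero
    have h3 : ∀ᶠ x in nhds (0 : ℝ), ψ (-Real.log x) = 0 := by
      have h4 := eventually_nhdsWithin_iff.1 (h2.eventually h1)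
      filter_upwards [h4] with x hx
      by_cases hx0 : x = 0
      · simp [hx0, h0]
      · exact hx hx0
    have h5 : (fun x => ψ (-Real.log x)) =ᶠ[nhds 0] fun _ => 0 := h3
    exact (continuousAt_const.congr h5.symm)
  · exact hψ.continuousAt.comp (Real.continuousAt_log hx).neg

/-- A function is determined almost everywhere by its Laplace transform near infinity. -/
theorem ae_eq_of_laplace_eq {σ : ℝ} {f g : ℝ → ℝ} (hf : LaplaceIntegrable σ f)
    (hg : LaplaceIntegrable σ g) (h : ∀ s, σ ≤ s → laplace f s = laplace g s) :
    ∀ᵐ t ∂volume.restrict (Ioi (0 : ℝ)), f t = g t := by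
  set u : ℝ → ℝ := fun t => Real.exp (-(σ * t)) * (f t - g t) with hu
  have hui : IntegrableOn u (Ioi 0) := hf.sub hg
  -- The transforms at the points `σ + k` are the moments of the weighted difference `u` in the
  -- variable `e^(-t)`.
  have hmom : ∀ k : ℕ, ∫ t in Ioi 0, Real.exp (-t) ^ k * u t = 0 := by
    intro k
    have hk : σ ≤ k + σ := by
      have := k.cast_nonneg (α := ℝ)
      linarith
    simp only [hu, ← mul_assoc, exp_neg_pow_mul_exp]
    have := laplace_sub (hf.mono hk) (hg.mono hk)
    rw [laplace] at this
    rw [this, h _ hk, sub_self]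
  have htest : ∀ ψ : ℝ → ℝ, Continuous ψ → HasCompactSupport ψ → ψ 0 = 0 →
      ∫ t in Ioi 0, ψ t * u t = 0 := by
    intro ψ hψ hc h0
    -- A constant family along a trivial filter, compared with the limit `0`: the convergence
    -- statement becomes an identity.
    have h1 := tendsto_integral_comp_exp_neg_mul (l := (pure () : Filter Unit))
      (F := fun _ => u) (G := fun _ => 0) (M := ∫ t in Ioi 0, |u t|)
      (Eventually.of_forall fun _ => hui) integrableOn_zero (Eventually.of_forall fun _ => le_rfl)
      (fun k => by simp [hmom k]) (continuous_comp_neg_log hψ hc h0)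
    have h2 := tendsto_nhds_unique h1 tendsto_const_nhds
    simpa using h2.symm
  have hzero := isOpen_Ioi.ae_eq_zero_of_integral_contDiff_smul_eq_zero (f := u) (U := Ioi 0)
    hui.locallyIntegrableOn fun ψ hψ hc hs => by
      have h0 : ∀ t, t ∉ Ioi (0 : ℝ) → ψ t = 0 := fun t ht =>
        image_eq_zero_of_notMem_tsupport fun h => ht (hs h)
      rw [← htest ψ hψ.continuous hc (h0 0 (by simp))]
      rw [setIntegral_eq_integral_of_forall_compl_eq_zero]
      · simp
      · intro t ht
        rw [h0 t ht, zero_mul]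
  rw [ae_restrict_iff' measurableSet_Ioi]
  filter_upwards [hzero] with t ht hpos
  have := ht hpos
  simp only [hu, mul_eq_zero, (Real.exp_pos _).ne', false_or] at this
  linarith

/-! ### Karamata's Tauberian theorem. -/

/-- A tent in the variable `e^(-t)`. It confines `t` to a window on one side of `1`, where
monotonicity compares `S (l * t)` with `S l`. -/
theorem exists_continuous_bump_comp_exp_neg {u v : ℝ} (hu : 0 < u) (huv : u < v) :
    ∃ h : ℝ → ℝ, Continuous h ∧ (∀ x, 0 ≤ h x) ∧
      (∀ t, h (Real.exp (-t)) ≠ 0 → t ∈ Icc u v) ∧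
      0 < ∫ t in Ioi 0, h (Real.exp (-t)) * Real.exp (-t) := by
  set h : ℝ → ℝ := fun x => max 0 (min (x - Real.exp (-v)) (Real.exp (-u) - x)) with hdef
  have hc : Continuous h := by fun_prop
  have h0 : ∀ x, 0 ≤ h x := fun x => le_max_left _ _
  refine ⟨h, hc, h0, ?_, ?_⟩
  · intro t ht
    by_contra hn
    refine ht (max_eq_left ?_)
    rw [mem_Icc, not_and_or, not_le, not_le] at hn
    rcases hn with hn | hn
    · exact (min_le_right _ _).trans (sub_nonpos.2 (Real.exp_le_exp.2 (by linarith)))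
    · exact (min_le_left _ _).trans (sub_nonpos.2 (Real.exp_le_exp.2 (by linarith)))
  · have hi : IntegrableOn (fun t : ℝ => Real.exp (-t)) (Ioi 0) := by
      simpa [LaplaceIntegrable] using laplaceIntegrable_one one_pos
    rw [integral_pos_iff_support_of_nonneg (fun t => mul_nonneg (h0 _) (Real.exp_pos _).le)
      (hc.integrableOn_comp_exp_neg_mul hi)]
    have hsub : Ioo u v ⊆ Function.support fun t => h (Real.exp (-t)) * Real.exp (-t) := by
      intro t ht
      refine (mul_pos ?_ (Real.exp_pos _)).ne'
      exact lt_max_of_lt_right (lt_min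
        (sub_pos.2 (Real.exp_lt_exp.2 (by linarith [ht.2])))
        (sub_pos.2 (Real.exp_lt_exp.2 (by linarith [ht.1]))))
    refine lt_of_lt_of_le ?_ (measure_mono hsub)
    rw [Measure.restrict_apply measurableSet_Ioo,
      inter_eq_left.2 fun t (ht : t ∈ Ioo u v) => mem_Ioi.2 (hu.trans ht.1)]
    simpa using huv

/-- Scaled Laplace integrals. -/
theorem integral_exp_neg_mul_comp_mul (S : ℝ → ℝ) {c l : ℝ} (hl : 0 < l) :
    ∫ t in Ioi 0, Real.exp (-(c * t)) * S (l * t) = l⁻¹ * laplace S (c / l) := by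
  have h := integral_comp_mul_left_Ioi (fun t => Real.exp (-(c / l * t)) * S t) 0 hl
  rw [mul_zero, smul_eq_mul] at h
  rw [laplace, ← h]
  refine integral_congr_ae (Eventually.of_forall fun t => ?_)
  have : c / l * (l * t) = c * t := by field_simp
  simp only [this]

theorem LaplaceIntegrable.comp_mul {S : ℝ → ℝ} {c l : ℝ} (hl : 0 < l)
    (hS : LaplaceIntegrable (c / l) S) : LaplaceIntegrable c (fun t => S (l * t)) := by
  have h := (integrableOn_Ioi_comp_mul_left_iff
    (fun t => Real.exp (-(c / l * t)) * S t) 0 hl).2 (by simpa [LaplaceIntegrable] using hS)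
  refine h.congr (Eventually.of_forall fun t => ?_)
  have : c / l * (l * t) = c * t := by field_simp
  simp only [this]

/-- Substituting `s = c/l` in the hypothesis gives the limit `C c^(-(1-η))`. Written as a transform,
it shows that `l^η S(l t) dt` has the moments of `C g_{1-η}(t) dt` in the limit. -/
theorem tendsto_rpow_mul_laplace_scaled {S : ℝ → ℝ} {η C : ℝ} (hη : η < 1)
    (hlim : Tendsto (fun s => s ^ (1 - η) * laplace S s) (nhdsWithin 0 (Ioi 0)) (nhds C))
    {c : ℝ} (hc : 0 < c) :
    Tendsto (fun l : ℝ => l ^ η * (l⁻¹ * laplace S (c / l))) atTop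
      (nhds (C * laplace (fracKernel (1 - η)) c)) := by
  have h1 : Tendsto (fun l : ℝ => c / l) atTop (nhdsWithin 0 (Ioi 0)) := by
    refine tendsto_nhdsWithin_iff.2 ⟨tendsto_const_nhds.div_atTop tendsto_id, ?_⟩
    filter_upwards [eventually_gt_atTop 0] with l hl
    exact div_pos hc hl
  rw [laplace_fracKernel (by linarith) hc]
  refine ((hlim.comp h1).mul_const (c ^ (-(1 - η)))).congr' ?_
  filter_upwards [eventually_gt_atTop 0] with l hl
  simp only [Function.comp_apply]
  have e1 : (c / l) ^ (1 - η) = c ^ (1 - η) * l ^ (η - 1) := by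
    rw [Real.div_rpow hc.le hl.le, div_eq_mul_inv, ← Real.rpow_neg hl.le]
    ring_nf
  have e2 : l ^ (η - 1) = l ^ η * l⁻¹ := by
    rw [Real.rpow_sub_one hl.ne', div_eq_mul_inv]
  have e3 : c ^ (1 - η) * c ^ (-(1 - η)) = 1 := by
    rw [← Real.rpow_add hc]
    simp
  rw [e1, e2]
  linear_combination (l ^ η * l⁻¹ * laplace S (c / l)) * e3

/-- **Karamata's Tauberian theorem** for nonincreasing functions. -/
theorem tendsto_rpow_mul_of_tendsto_laplace {S : ℝ → ℝ} (hS : AntitoneOn S (Ioi 0))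
    (h0 : ∀ t, 0 < t → 0 ≤ S t) (hint : ∀ s, 0 < s → LaplaceIntegrable s S) {η C : ℝ}
    (hη : 0 < η) (hη1 : η < 1)
    (hlim : Tendsto (fun s => s ^ (1 - η) * laplace S s) (nhdsWithin 0 (Ioi 0)) (nhds C)) :
    Tendsto (fun t => t ^ η * S t) atTop (nhds (C / Real.Gamma (1 - η))) := by
  have hC : 0 ≤ C := by
    refine ge_of_tendsto hlim ?_
    filter_upwards [self_mem_nhdsWithin] with s hs
    exact mul_nonneg (Real.rpow_nonneg (le_of_lt hs) _) (setIntegral_nonneg measurableSet_Ioi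
      fun t ht => mul_nonneg (Real.exp_pos _).le (h0 t ht))
  have hΓ : 0 < Real.Gamma (1 - η) := Real.Gamma_pos_of_pos (by linarith)
  set D := C / Real.Gamma (1 - η) with hD
  have hD0 : 0 ≤ D := div_nonneg hC hΓ.le
  -- Rescaled functions and their expected limit. The weight `e^(-t)` makes both integrable and
  -- turns transforms at `k + 1` into `k`-th moments.
  set F : ℝ → ℝ → ℝ := fun l t => l ^ η * (Real.exp (-(1 * t)) * S (l * t)) with hFdef
  set G : ℝ → ℝ := fun t => C * (Real.exp (-(1 * t)) * fracKernel (1 - η) t) with hGdef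
  have hG : IntegrableOn G (Ioi 0) :=
    (laplaceIntegrable_fracKernel (by linarith) one_pos).const_mul' C
  have hF : ∀ᶠ l in atTop, IntegrableOn (F l) (Ioi 0) := by
    filter_upwards [eventually_gt_atTop 0] with l hl
    exact ((hint (1 / l) (by positivity)).comp_mul hl).const_mul' _
  have hmom : ∀ k : ℕ, Tendsto (fun l => ∫ t in Ioi 0, Real.exp (-t) ^ k * F l t) atTop
      (nhds (∫ t in Ioi 0, Real.exp (-t) ^ k * G t)) := by
    intro k
    have hk : (0 : ℝ) < k + 1 := by positivity
    have hfac : ∀ (A : ℝ) (f : ℝ → ℝ),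
        ∫ t in Ioi 0, Real.exp (-t) ^ k * (A * (Real.exp (-(1 * t)) * f t)) =
          A * ∫ t in Ioi 0, Real.exp (-((k + 1) * t)) * f t := by
      intro A f
      rw [← integral_const_mul]
      refine integral_congr_ae (Eventually.of_forall fun t => ?_)
      simp only [← exp_neg_pow_mul_exp]
      ring
    simp only [hFdef, hGdef, hfac]
    refine (tendsto_rpow_mul_laplace_scaled hη1 hlim hk).congr' ?_
    filter_upwards [eventually_gt_atTop 0] with l hl
    rw [integral_exp_neg_mul_comp_mul S hl]
  have hbdd : ∀ᶠ l in atTop, ∫ t in Ioi 0, |F l t| ≤ (∫ t in Ioi 0, G t) + 1 := by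
    have h := hmom 0
    simp only [pow_zero, one_mul] at h
    filter_upwards [h.eventually_le_const (lt_add_one _), eventually_gt_atTop 0] with l h1 hl
    refine le_trans (le_of_eq (setIntegral_congr_fun measurableSet_Ioi fun t ht => ?_)) h1
    exact abs_of_nonneg (mul_nonneg (Real.rpow_nonneg hl.le _)
      (mul_nonneg (Real.exp_pos _).le (h0 _ (mul_pos hl ht))))
  have htest := fun {h : ℝ → ℝ} (hh : Continuous h) =>
    tendsto_integral_comp_exp_neg_mul hF hG hbdd hmom hh
  have hexp : IntegrableOn (fun t : ℝ => Real.exp (-t)) (Ioi 0) := by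
    simpa [LaplaceIntegrable] using laplaceIntegrable_one one_pos
  have hGt : ∀ h : ℝ → ℝ, ∀ t, h (Real.exp (-t)) * G t =
      D * t ^ (-η) * (h (Real.exp (-t)) * Real.exp (-t)) := by
    intro h t
    simp only [hGdef, fracKernel, hD, one_mul, sub_sub_cancel_left]
    ring
  have hcont : Tendsto (fun u : ℝ => D * u ^ (-η)) (nhds 1) (nhds D) := by
    have h := ((Real.continuousAt_rpow_const 1 (-η) (Or.inl one_ne_zero)).const_mul D).tendsto
    simpa using h
  refine tendsto_order.2 ⟨fun D' hD' => ?_, fun D' hD' => ?_⟩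
  -- Lower bound: on the window `[1, v]` one has `S (l * t) ≤ S l`, while the limit density loses at
  -- most the factor `v^(-η)`, close to `1`.
  · obtain ⟨v, hv1, hvD⟩ : ∃ v : ℝ, 1 < v ∧ D' < D * v ^ (-η) := by
      have h1 := (hcont.mono_left (nhdsWithin_le_nhds (s := Ioi 1))).eventually_const_lt hD'
      obtain ⟨v, h2, h3⟩ := (h1.and self_mem_nhdsWithin).exists
      exact ⟨v, h3, h2⟩
    obtain ⟨h, hh, hh0, hsupp, hW⟩ := exists_continuous_bump_comp_exp_neg one_pos hv1
    set W := ∫ t in Ioi 0, h (Real.exp (-t)) * Real.exp (-t)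
    have hlow : D * v ^ (-η) * W ≤ ∫ t in Ioi 0, h (Real.exp (-t)) * G t := by
      rw [← integral_const_mul]
      refine setIntegral_mono_on ((hh.integrableOn_comp_exp_neg_mul hexp).const_mul _)
        (hh.integrableOn_comp_exp_neg_mul hG) measurableSet_Ioi fun t ht => ?_
      rw [hGt]
      by_cases hz : h (Real.exp (-t)) = 0
      · simp [hz]
      · have ht : 0 < t := ht
        refine mul_le_mul_of_nonneg_right ?_ (mul_nonneg (hh0 _) (Real.exp_pos _).le)
        refine mul_le_mul_of_nonneg_left ?_ hD0
        exact Real.rpow_le_rpow_of_nonpos ht (hsupp t hz).2 (by linarith)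
    have h1 : D' * W < ∫ t in Ioi 0, h (Real.exp (-t)) * G t :=
      lt_of_lt_of_le (mul_lt_mul_of_pos_right hvD hW) hlow
    filter_upwards [(htest hh).eventually_const_lt h1, hF, eventually_gt_atTop 0] with l h2 hFl hl
    refine lt_of_mul_lt_mul_right (lt_of_lt_of_le h2 ?_) hW.le
    rw [← integral_const_mul]
    refine setIntegral_mono_on (hh.integrableOn_comp_exp_neg_mul hFl)
      ((hh.integrableOn_comp_exp_neg_mul hexp).const_mul _) measurableSet_Ioi fun t ht => ?_
    by_cases hz : h (Real.exp (-t)) = 0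
    · simp [hz]
    · have ht : 0 < t := ht
      have h3 : S (l * t) ≤ S l :=
        hS hl (mul_pos hl ht) (le_mul_of_one_le_right hl.le (hsupp t hz).1)
      have h4 : 0 ≤ l ^ η * (h (Real.exp (-t)) * Real.exp (-t)) :=
        mul_nonneg (Real.rpow_nonneg hl.le _) (mul_nonneg (hh0 _) (Real.exp_pos _).le)
      have h5 := mul_le_mul_of_nonneg_left h3 h4
      simp only [hFdef, one_mul]
      linarith
  -- Upper bound: the same argument on a window `[u, 1]`, with both inequalities reversed.
  · obtain ⟨u, hu0, hu1, huD⟩ : ∃ u : ℝ, 0 < u ∧ u < 1 ∧ D * u ^ (-η) < D' := by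
      have h1 := (hcont.mono_left (nhdsWithin_le_nhds (s := Iio 1))).eventually_lt_const hD'
      have h4 : ∀ᶠ u : ℝ in nhdsWithin 1 (Iio 1), 0 < u :=
        nhdsWithin_le_nhds (lt_mem_nhds one_pos)
      obtain ⟨v, ⟨h2, h3⟩, h4⟩ := ((h1.and self_mem_nhdsWithin).and h4).exists
      exact ⟨v, h4, h3, h2⟩
    obtain ⟨h, hh, hh0, hsupp, hW⟩ := exists_continuous_bump_comp_exp_neg hu0 hu1
    set W := ∫ t in Ioi 0, h (Real.exp (-t)) * Real.exp (-t)
    have hup : (∫ t in Ioi 0, h (Real.exp (-t)) * G t) ≤ D * u ^ (-η) * W := by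
      rw [← integral_const_mul]
      refine setIntegral_mono_on (hh.integrableOn_comp_exp_neg_mul hG)
        ((hh.integrableOn_comp_exp_neg_mul hexp).const_mul _) measurableSet_Ioi fun t ht => ?_
      rw [hGt]
      by_cases hz : h (Real.exp (-t)) = 0
      · simp [hz]
      · refine mul_le_mul_of_nonneg_right ?_ (mul_nonneg (hh0 _) (Real.exp_pos _).le)
        refine mul_le_mul_of_nonneg_left ?_ hD0
        exact Real.rpow_le_rpow_of_nonpos hu0 (hsupp t hz).1 (by linarith)
    have h1 : (∫ t in Ioi 0, h (Real.exp (-t)) * G t) < D' * W :=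
      lt_of_le_of_lt hup (mul_lt_mul_of_pos_right huD hW)
    filter_upwards [(htest hh).eventually_lt_const h1, hF, eventually_gt_atTop 0] with l h2 hFl hl
    refine lt_of_mul_lt_mul_right (lt_of_le_of_lt ?_ h2) hW.le
    rw [← integral_const_mul]
    refine setIntegral_mono_on ((hh.integrableOn_comp_exp_neg_mul hexp).const_mul _)
      (hh.integrableOn_comp_exp_neg_mul hFl) measurableSet_Ioi fun t ht => ?_
    by_cases hz : h (Real.exp (-t)) = 0
    · simp [hz]
    · have ht : 0 < t := ht
      have h3 : S l ≤ S (l * t) :=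
        hS (mul_pos hl ht) hl (mul_le_of_le_one_right hl.le (hsupp t hz).2)
      have h4 : 0 ≤ l ^ η * (h (Real.exp (-t)) * Real.exp (-t)) :=
        mul_nonneg (Real.rpow_nonneg hl.le _) (mul_nonneg (hh0 _) (Real.exp_pos _).le)
      have h5 := mul_le_mul_of_nonneg_left h3 h4
      simp only [hFdef, one_mul]
      linarith

/-! ### Series of fractional kernels. -/

/-- Only the part of Euler's integral over `[x, 2x]` is kept. Writing `u^(c-1)` as `u^c / u` treats
`c < 1` and `c ≥ 1` alike. -/
theorem half_mul_rpow_le_Gamma {c x : ℝ} (hc : 0 < c) (hx : 0 < x) :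
    x ^ c / 2 * Real.exp (-(2 * x)) ≤ Real.Gamma c := by
  rw [Real.Gamma_eq_integral hc]
  have hi := Real.GammaIntegral_convergent hc
  have hsub : Ioc x (2 * x) ⊆ Ioi 0 := fun u hu => hx.trans hu.1
  calc x ^ c / 2 * Real.exp (-(2 * x))
      = ∫ _ in Ioc x (2 * x), Real.exp (-(2 * x)) * (x ^ c / (2 * x)) := by
        rw [setIntegral_const, Real.volume_real_Ioc_of_le (by linarith), smul_eq_mul]
        field_simp
        ring
    _ ≤ ∫ u in Ioc x (2 * x), Real.exp (-u) * u ^ (c - 1) := by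
        refine setIntegral_mono_on (integrableOn_const (by simp)) (hi.mono_set hsub) measurableSet_Ioc fun u hu => ?_
        have hu0 : 0 < u := hsub hu
        rw [Real.rpow_sub_one hu0.ne']
        gcongr
        · exact hu.2
        · exact hu.1.le
        · exact hu.2
    _ ≤ ∫ u in Ioi 0, Real.exp (-u) * u ^ (c - 1) := by
        refine setIntegral_mono_set hi ?_ hsub.eventuallyLE
        filter_upwards [ae_restrict_mem measurableSet_Ioi] with u hu
        exact mul_nonneg (Real.exp_pos _).le (Real.rpow_nonneg (le_of_lt hu) _)

/-- The Gamma bound at `x = σ t`. The dependence on `c` is exactly `σ^(-c)`, so summability of the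
transforms at `σ` also yields locally uniform convergence of the series itself. -/
theorem fracKernel_le {c t σ : ℝ} (hc : 0 < c) (ht : 0 < t) (hσ : 0 < σ) :
    fracKernel c t ≤ 2 / t * Real.exp (2 * (σ * t)) * σ ^ (-c) := by
  have h := half_mul_rpow_le_Gamma hc (mul_pos hσ ht)
  have hΓ := Real.Gamma_pos_of_pos hc
  rw [Real.mul_rpow hσ.le ht.le, Real.exp_neg] at h
  rw [fracKernel, Real.rpow_sub_one ht.ne', Real.rpow_neg hσ.le, div_le_iff₀ hΓ]
  have hσc := Real.rpow_pos_of_pos hσ c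
  have he := Real.exp_pos (2 * (σ * t))
  calc t ^ c / t = 2 / t * Real.exp (2 * (σ * t)) * (σ ^ c)⁻¹ *
        (σ ^ c * t ^ c / 2 * (Real.exp (2 * (σ * t)))⁻¹) := by field_simp
    _ ≤ _ := by gcongr

/-- A generalized fractional power series, a combination of fractional kernels. -/
noncomputable def fracSeries {ι : Type*} (w c : ι → ℝ) (t : ℝ) : ℝ :=
  ∑' i, w i * fracKernel (c i) t

section FracSeries

variable {ι : Type*} {w c : ι → ℝ} {σ : ℝ}

theorem summable_fracSeries (hσ : 0 < σ) (hc : ∀ i, 0 < c i)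
    (hw : Summable fun i => |w i| * σ ^ (-c i)) {t : ℝ} (ht : 0 < t) :
    Summable fun i => |w i| * fracKernel (c i) t := by
  refine Summable.of_nonneg_of_le
    (fun i => mul_nonneg (abs_nonneg _) (fracKernel_pos (hc i) ht).le) (fun i => ?_)
    (hw.mul_left (2 / t * Real.exp (2 * (σ * t))))
  calc |w i| * fracKernel (c i) t
      ≤ |w i| * (2 / t * Real.exp (2 * (σ * t)) * σ ^ (-c i)) :=
        mul_le_mul_of_nonneg_left (fracKernel_le (hc i) ht hσ) (abs_nonneg _)
    _ = _ := by ring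

theorem continuousOn_fracSeries (hσ : 0 < σ) (hc : ∀ i, 0 < c i)
    (hw : Summable fun i => |w i| * σ ^ (-c i)) : ContinuousOn (fracSeries w c) (Ioi 0) := by
  intro t ht
  have ht : 0 < t := ht
  have h : ContinuousOn (fracSeries w c) (Ioo (t / 2) (2 * t)) := by
    refine continuousOn_tsum (u := fun i => 4 / t * Real.exp (2 * (σ * (2 * t))) *
      (|w i| * σ ^ (-c i))) (fun i => ?_) (hw.mul_left _) fun i x hx => ?_
    · exact continuousOn_const.mul ((continuousOn_fracKernel _).mono fun x hx =>
        lt_trans (by positivity) hx.1)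
    · have hx0 : 0 < x := lt_trans (by positivity) hx.1
      rw [norm_mul, Real.norm_eq_abs, Real.norm_of_nonneg (fracKernel_pos (hc i) hx0).le]
      have h1 : fracKernel (c i) x ≤ 4 / t * Real.exp (2 * (σ * (2 * t))) * σ ^ (-c i) := by
        refine (fracKernel_le (hc i) hx0 hσ).trans ?_
        have h2 : 2 / x ≤ 4 / t := by
          rw [div_le_div_iff₀ hx0 ht]
          linarith [hx.1]
        gcongr
        exact hx.2.le
      calc _ ≤ |w i| * (4 / t * Real.exp (2 * (σ * (2 * t))) * σ ^ (-c i)) :=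
            mul_le_mul_of_nonneg_left h1 (abs_nonneg _)
        _ = _ := by ring
  exact (h.continuousAt (Ioo_mem_nhds (by linarith) (by linarith))).continuousWithinAt

/-- With `p` below all exponents, `t^(c-p) ≤ T^(c-p)` on `(0, T]`, so `t^(p-1)` factors out and the
series at `T` remains. -/
theorem abs_fracSeries_le (hσ : 0 < σ) (hc : ∀ i, 0 < c i)
    (hw : Summable fun i => |w i| * σ ^ (-c i)) {p : ℝ} (hp : ∀ i, p ≤ c i) {T : ℝ}
    (hT : 0 < T) : ∃ C, ∀ t ∈ Ioc 0 T, |fracSeries w c t| ≤ C * t ^ (p - 1) := by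
  refine ⟨T ^ (1 - p) * ∑' i, |w i| * fracKernel (c i) T, fun t ht => ?_⟩
  have hsum := summable_fracSeries hσ hc hw hT
  have hterm : ∀ i, ‖w i * fracKernel (c i) t‖ ≤
      T ^ (1 - p) * t ^ (p - 1) * (|w i| * fracKernel (c i) T) := by
    intro i
    rw [norm_mul, Real.norm_eq_abs, Real.norm_of_nonneg (fracKernel_pos (hc i) ht.1).le]
    have h1 : t ^ (c i - 1) ≤ T ^ (1 - p) * t ^ (p - 1) * T ^ (c i - 1) := by
      calc t ^ (c i - 1) = t ^ (p - 1) * t ^ (c i - p) := by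
            rw [← Real.rpow_add ht.1]
            ring_nf
        _ ≤ t ^ (p - 1) * T ^ (c i - p) := by
            have := ht.1
            gcongr
            · linarith [hp i]
            · exact ht.2
        _ = T ^ (1 - p) * t ^ (p - 1) * T ^ (c i - 1) := by
            have : T ^ (c i - p) = T ^ (1 - p) * T ^ (c i - 1) := by
              rw [← Real.rpow_add hT]
              ring_nf
            rw [this]
            ring
    have h2 : fracKernel (c i) t ≤ T ^ (1 - p) * t ^ (p - 1) * fracKernel (c i) T := by
      rw [fracKernel, fracKernel, ← mul_div_assoc]
      exact div_le_div_of_nonneg_right h1 (Real.Gamma_pos_of_pos (hc i)).le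
    calc _ ≤ |w i| * (T ^ (1 - p) * t ^ (p - 1) * fracKernel (c i) T) :=
          mul_le_mul_of_nonneg_left h2 (abs_nonneg _)
      _ = _ := by ring
  have hs2 := hsum.mul_left (T ^ (1 - p) * t ^ (p - 1))
  calc |fracSeries w c t| ≤ ∑' i, T ^ (1 - p) * t ^ (p - 1) * (|w i| * fracKernel (c i) T) :=
        tsum_of_norm_bounded hs2.hasSum hterm
    _ = _ := by
        rw [tsum_mul_left]
        ring

/-- The weighted `L¹` norm of the `i`-th term is exactly `|w i| σ^(-c i)`, so summation and
integration may be interchanged. -/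
theorem hasSum_laplace_fracSeries [Countable ι] (hσ : 0 < σ) (hc : ∀ i, 0 < c i)
    (hw : Summable fun i => |w i| * σ ^ (-c i)) :
    LaplaceIntegrable σ (fracSeries w c) ∧
      HasSum (fun i => w i * σ ^ (-c i)) (laplace (fracSeries w c) σ) := by
  set F : ι → ℝ → ℝ := fun i t => Real.exp (-(σ * t)) * (w i * fracKernel (c i) t) with hFdef
  have hF : ∀ i, IntegrableOn (F i) (Ioi 0) := fun i =>
    (laplaceIntegrable_fracKernel (hc i) hσ).const_mul (w i)
  have hval : ∀ i, ∫ t in Ioi 0, F i t = w i * σ ^ (-c i) := fun i => by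
    rw [← laplace_fracKernel (hc i) hσ, ← laplace_const_mul]
    rfl
  have hnorm : ∀ i, ∫ t in Ioi 0, ‖F i t‖ = |w i| * σ ^ (-c i) := fun i => by
    rw [← laplace_fracKernel (hc i) hσ, ← laplace_const_mul]
    refine setIntegral_congr_fun measurableSet_Ioi fun t ht => ?_
    simp only [hFdef]
    rw [norm_mul, norm_mul, Real.norm_of_nonneg (Real.exp_pos _).le, Real.norm_eq_abs,
      Real.norm_of_nonneg (fracKernel_pos (hc i) ht).le]
  have hsumn : Summable fun i => ∫ t in Ioi 0, ‖F i t‖ := by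
    simpa only [hnorm] using hw
  have htsum : ∀ t, Real.exp (-(σ * t)) * fracSeries w c t = ∑' i, F i t := fun t => by
    rw [fracSeries, ← tsum_mul_left]
  constructor
  · constructor
    · exact (by fun_prop : Continuous fun t : ℝ => Real.exp (-(σ * t))).aestronglyMeasurable.mul
        ((continuousOn_fracSeries hσ hc hw).aestronglyMeasurable measurableSet_Ioi)
    · calc ∫⁻ t in Ioi 0, ‖Real.exp (-(σ * t)) * fracSeries w c t‖ₑ
          ≤ ∫⁻ t in Ioi 0, ∑' i, ‖F i t‖ₑ := by
            refine lintegral_mono fun t => ?_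
            simp only [htsum]
            exact enorm_tsum_le_tsum_enorm
        _ = ∑' i, ∫⁻ t in Ioi 0, ‖F i t‖ₑ :=
            lintegral_tsum fun i => (hF i).aestronglyMeasurable.enorm
        _ = ∑' i, ENNReal.ofReal (∫ t in Ioi 0, ‖F i t‖) := by
            simp only [ofReal_integral_norm_eq_lintegral_enorm (hF _)]
        _ = ENNReal.ofReal (∑' i, ∫ t in Ioi 0, ‖F i t‖) :=
            (ENNReal.ofReal_tsum_of_nonneg (fun i => integral_nonneg fun _ => norm_nonneg _)
              hsumn).symm
        _ < ⊤ := ENNReal.ofReal_lt_top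
  · have h := hasSum_integral_of_summable_integral_norm hF hsumn
    simpa only [hval, ← htsum, laplace] using h

end FracSeries

/-! ### Transforms of the Mittag-Leffler densities. -/

section MittagLeffler

theorem mittagLefflerDensity_eq_fracSeries {α β t : ℝ} (ht : 0 < t) :
    mittagLefflerDensity α β t =
      fracSeries (fun k : ℕ => β * (-β) ^ k) (fun k : ℕ => α + k * α) t := by
  rw [mittagLefflerDensity, mittagLeffler, fracSeries, ← tsum_mul_left]
  refine tsum_congr fun k => ?_
  have h : t ^ (α + k * α - 1) = t ^ (α - 1) * (t ^ α) ^ k := by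
    rw [← Real.rpow_natCast, ← Real.rpow_mul ht.le, ← Real.rpow_add ht]
    ring_nf
  rw [fracKernel, h, mul_pow]
  ring

/-- Termwise, a geometric series of ratio `-β s^(-α)`. It converges absolutely only for large `s`,
which is enough to identify the kernel and its resolvent. -/
theorem laplace_mittagLefflerDensity {α β s : ℝ} (hα : 0 < α) (hβ : 0 < β) (hs : 0 < s)
    (h : β * s ^ (-α) < 1) : LaplaceIntegrable s (mittagLefflerDensity α β) ∧
      laplace (mittagLefflerDensity α β) s = β * s ^ (-α) / (1 + β * s ^ (-α)) := by
  have hx : 0 < β * s ^ (-α) := mul_pos hβ (Real.rpow_pos_of_pos hs _)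
  have hc : ∀ k : ℕ, 0 < α + k * α := fun k => by positivity
  have hpow : ∀ k : ℕ, s ^ (-(α + k * α)) = s ^ (-α) * (s ^ (-α)) ^ k := fun k => by
    rw [← Real.rpow_natCast, ← Real.rpow_mul hs.le, ← Real.rpow_add hs]
    ring_nf
  have hw : Summable fun k : ℕ => |β * (-β) ^ k| * s ^ (-(α + k * α)) := by
    refine ((summable_geometric_of_lt_one hx.le h).mul_left (β * s ^ (-α))).congr fun k => ?_
    rw [abs_mul, abs_pow, abs_neg, abs_of_pos hβ, hpow, mul_pow]
    ring
  obtain ⟨h1, h2⟩ := hasSum_laplace_fracSeries hs hc hw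
  have hae : ∀ᵐ t ∂volume.restrict (Ioi (0 : ℝ)),
      fracSeries (fun k : ℕ => β * (-β) ^ k) (fun k : ℕ => α + k * α) t =
        mittagLefflerDensity α β t := by
    filter_upwards [ae_restrict_mem measurableSet_Ioi] with t ht
    exact (mittagLefflerDensity_eq_fracSeries ht).symm
  refine ⟨h1.congr hae, ?_⟩
  rw [← laplace_congr hae, ← h2.tsum_eq]
  have hg := (hasSum_geometric_of_abs_lt_one (r := -(β * s ^ (-α)))
    (by rwa [abs_neg, abs_of_pos hx])).mul_left (β * s ^ (-α))
  rw [sub_neg_eq_add] at hg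
  rw [div_eq_mul_inv, ← hg.tsum_eq]
  refine tsum_congr fun k => ?_
  rw [hpow, neg_mul_eq_neg_mul, mul_pow]
  ring

end MittagLeffler

/-! ### The Neumann series as a sum over words. -/

section WordSeries

variable {κ : Type*}

theorem rpow_neg_sum_word {a : κ → ℝ} {s : ℝ} (hs : 0 < s) {n : ℕ} (p : Fin n → κ) :
    s ^ (-∑ i, a (p i)) = ∏ i, s ^ (-a (p i)) := by
  rw [← Finset.sum_neg_distrib, Real.rpow_sum_of_pos hs]

variable [Fintype κ]

/-- The Neumann series of the resolvent of `∑ j, b j * fracKernel (a j)`, as a sum over words. -/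
noncomputable def fracResolvent (b a : κ → ℝ) : ℝ → ℝ :=
  fracSeries (fun p : Σ n : ℕ, Fin (n + 1) → κ => -∏ i, -b (p.2 i))
    (fun p : Σ n : ℕ, Fin (n + 1) → κ => ∑ i, a (p.2 i))

variable {b a : κ → ℝ} {s : ℝ}

/-- By distributivity, the words of length `n + 1` contribute the `(n+1)`-st power of the symbol.
The empty word is absent, so every exponent is a nonempty sum. -/
theorem summable_fracResolvent (hb : ∀ j, 0 ≤ b j) (hs : 0 < s)
    (h : ∑ j, b j * s ^ (-a j) < 1) :
    Summable fun p : Σ n : ℕ, Fin (n + 1) → κ =>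
      |-∏ i, -b (p.2 i)| * s ^ (-∑ i, a (p.2 i)) := by
  have hx : ∀ j, 0 ≤ b j * s ^ (-a j) := fun j => mul_nonneg (hb j) (Real.rpow_nonneg hs.le _)
  have hterm : ∀ p : Σ n : ℕ, Fin (n + 1) → κ,
      |-∏ i, -b (p.2 i)| * s ^ (-∑ i, a (p.2 i)) = ∏ i, b (p.2 i) * s ^ (-a (p.2 i)) := fun p => by
    rw [rpow_neg_sum_word hs, Finset.prod_mul_distrib, abs_neg, Finset.abs_prod]
    simp only [abs_neg, abs_of_nonneg (hb _)]
  simp only [hterm]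
  have hsum : ∀ n : ℕ, ∑' q : Fin (n + 1) → κ, ∏ i, b (q i) * s ^ (-a (q i)) =
      (∑ j, b j * s ^ (-a j)) ^ (n + 1) := fun n => by
    rw [tsum_fintype, Fintype.sum_pow]
  refine (summable_sigma_of_nonneg fun p => Finset.prod_nonneg fun i _ => hx _).2
    ⟨fun n => Summable.of_finite, ?_⟩
  refine Summable.congr ?_ fun n => (hsum n).symm
  exact (summable_nat_add_iff 1).2
    (summable_geometric_of_lt_one (Finset.sum_nonneg fun j _ => hx j) h)

/-- The sign of a word of length `n + 1` is `(-1)^n`; grouping by length gives `X - X² + X³ - ⋯ =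
X/(1+X)`. -/
theorem laplace_fracResolvent [Nonempty κ] (hb : ∀ j, 0 ≤ b j) (ha : ∀ j, 0 < a j) (hs : 0 < s)
    (h : ∑ j, b j * s ^ (-a j) < 1) : LaplaceIntegrable s (fracResolvent b a) ∧
      laplace (fracResolvent b a) s =
        (∑ j, b j * s ^ (-a j)) / (1 + ∑ j, b j * s ^ (-a j)) := by
  have hx : ∀ j, 0 ≤ b j * s ^ (-a j) := fun j => mul_nonneg (hb j) (Real.rpow_nonneg hs.le _)
  have hX : 0 ≤ ∑ j, b j * s ^ (-a j) := Finset.sum_nonneg fun j _ => hx j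
  have hc : ∀ p : Σ n : ℕ, Fin (n + 1) → κ, 0 < ∑ i, a (p.2 i) := fun p =>
    Finset.sum_pos (fun i _ => ha _) Finset.univ_nonempty
  obtain ⟨h1, h2⟩ := hasSum_laplace_fracSeries hs hc (summable_fracResolvent hb hs h)
  refine ⟨h1, ?_⟩
  have hterm : ∀ p : Σ n : ℕ, Fin (n + 1) → κ,
      -(∏ i, -b (p.2 i)) * s ^ (-∑ i, a (p.2 i)) =
        -∏ i, -(b (p.2 i) * s ^ (-a (p.2 i))) := fun p => by
    simp only [rpow_neg_sum_word hs, neg_mul_eq_neg_mul, Finset.prod_mul_distrib]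
  simp only [hterm] at h2
  have hsum : ∀ n : ℕ, ∑ q : Fin (n + 1) → κ, -∏ i, -(b (q i) * s ^ (-a (q i))) =
      (∑ j, b j * s ^ (-a j)) * (-∑ j, b j * s ^ (-a j)) ^ n := fun n => by
    rw [Finset.sum_neg_distrib, ← Fintype.sum_pow (fun j => -(b j * s ^ (-a j))),
      Finset.sum_neg_distrib, pow_succ]
    ring
  have h3 := h2.sigma fun n => hasSum_fintype _
  have hg := (hasSum_geometric_of_abs_lt_one (r := -∑ j, b j * s ^ (-a j))
    (by rwa [abs_neg, abs_of_nonneg hX])).mul_left (∑ j, b j * s ^ (-a j))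
  rw [sub_neg_eq_add, ← div_eq_mul_inv] at hg
  refine h3.unique ?_
  simpa only [hsum] using hg

end WordSeries

/-! ### Beta integrals and convolution of power singularities. -/

theorem intervalIntegrable_beta {p q : ℝ} (hp : 0 < p) (hq : 0 < q) :
    IntervalIntegrable (fun u : ℝ => (1 - u) ^ (p - 1) * u ^ (q - 1)) volume 0 1 := by
  have h := Complex.betaIntegral_convergent (u := q) (v := p) (by simpa) (by simpa)
  rw [intervalIntegrable_iff_integrableOn_Ioc_of_le zero_le_one] at h ⊢
  refine IntegrableOn.congr_fun h.re (fun u hu => ?_) measurableSet_Ioc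
  norm_cast
  rw [← Complex.ofReal_cpow hu.1.le, ← Complex.ofReal_cpow (by linarith [hu.2]),
    RCLike.re_to_complex, Complex.re_mul_ofReal, Complex.ofReal_re]
  ring

theorem integral_beta {p q : ℝ} (hp : 0 < p) (hq : 0 < q) :
    ∫ u in (0 : ℝ)..1, (1 - u) ^ (p - 1) * u ^ (q - 1) =
      Real.Gamma p * Real.Gamma q / Real.Gamma (p + q) := by
  have h := ProbabilityTheory.beta_eq_betaIntegralReal q p hq hp
  rw [ProbabilityTheory.beta, Complex.betaIntegral,
    intervalIntegral.integral_of_le zero_le_one, ← RCLike.re_to_complex, ← integral_re] at h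
  · rw [mul_comm, add_comm, h, intervalIntegral.integral_of_le zero_le_one]
    refine setIntegral_congr_fun measurableSet_Ioc fun u hu => ?_
    norm_cast
    rw [← Complex.ofReal_cpow hu.1.le, ← Complex.ofReal_cpow (by linarith [hu.2]),
      RCLike.re_to_complex, Complex.re_mul_ofReal, Complex.ofReal_re]
    ring
  · have h := Complex.betaIntegral_convergent (u := q) (v := p) (by simpa) (by simpa)
    rwa [intervalIntegrable_iff_integrableOn_Ioc_of_le zero_le_one] at h

/-- The substitution `s = t u` fixes the interval of integration, so that limits in `t` can be taken
by dominated convergence. -/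
theorem halfLineConv_eq_mul_integral (f g : ℝ → ℝ) {t : ℝ} (ht : 0 < t) :
    halfLineConv f g t = t * ∫ u in (0 : ℝ)..1, f (t * (1 - u)) * g (t * u) := by
  have h := intervalIntegral.integral_comp_mul_left (a := 0) (b := 1)
    (fun s => f (t - s) * g s) ht.ne'
  rw [mul_zero, mul_one, smul_eq_mul] at h
  simp only [mul_sub, mul_one]
  rw [h, ← mul_assoc, mul_inv_cancel₀ ht.ne', one_mul]
  rfl

theorem ae_uIoc_mem_Ioo :
    ∀ᵐ u : ℝ, u ∈ Set.uIoc (0 : ℝ) 1 → u ∈ Ioo (0 : ℝ) 1 := by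
  filter_upwards [Measure.ae_ne volume (1 : ℝ)] with u h1 h2
  rw [uIoc_of_le zero_le_one] at h2
  exact ⟨h2.1, lt_of_le_of_ne h2.2 h1⟩

theorem aestronglyMeasurable_convIntegrand {f g : ℝ → ℝ} (hf : ContinuousOn f (Ioi 0))
    (hg : ContinuousOn g (Ioi 0)) {t : ℝ} (ht : 0 < t) :
    AEStronglyMeasurable (fun u => f (t * (1 - u)) * g (t * u))
      (volume.restrict (Set.uIoc 0 1)) := by
  rw [uIoc_of_le zero_le_one, ← restrict_Ioo_eq_restrict_Ioc]
  refine ContinuousOn.aestronglyMeasurable ?_ measurableSet_Ioo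
  refine (hf.comp (by fun_prop) fun u hu => ?_).mul (hg.comp (by fun_prop) fun u hu => ?_)
  · exact mul_pos ht (sub_pos.2 hu.2)
  · exact mul_pos ht hu.1

/-- The convolution of functions with power singularities at the origin is continuous. -/
theorem continuousOn_halfLineConv {f g : ℝ → ℝ} {p q : ℝ} (hp : 0 < p) (hq : 0 < q)
    (hf : ContinuousOn f (Ioi 0)) (hg : ContinuousOn g (Ioi 0))
    (hfb : ∀ T, 0 < T → ∃ C, ∀ t ∈ Ioc 0 T, |f t| ≤ C * t ^ (p - 1))
    (hgb : ∀ T, 0 < T → ∃ C, ∀ t ∈ Ioc 0 T, |g t| ≤ C * t ^ (q - 1)) :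
    ContinuousOn (halfLineConv f g) (Ioi 0) := by
  intro t₀ ht₀
  have ht₀ : 0 < t₀ := ht₀
  obtain ⟨C, hC⟩ := hfb (2 * t₀) (by positivity)
  obtain ⟨D, hD⟩ := hgb (2 * t₀) (by positivity)
  obtain ⟨K, hK⟩ := isCompact_Icc.exists_bound_of_continuousOn (s := Icc (t₀ / 2) (2 * t₀))
    (f := fun t => C * t ^ (p - 1) * (D * t ^ (q - 1))) (by
      intro t ht
      have h0 : t ≠ 0 := (lt_of_lt_of_le (by positivity) ht.1).ne'
      exact (((Real.continuousAt_rpow_const _ _ (Or.inl h0)).const_mul C).mul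
        ((Real.continuousAt_rpow_const _ _ (Or.inl h0)).const_mul D)).continuousWithinAt)
  have hnhds : ∀ᶠ t in nhds t₀, t ∈ Ioo (t₀ / 2) (2 * t₀) :=
    Ioo_mem_nhds (by linarith) (by linarith)
  have hmain : ContinuousAt (fun t => ∫ u in (0 : ℝ)..1, f (t * (1 - u)) * g (t * u)) t₀ := by
    refine intervalIntegral.continuousAt_of_dominated_interval
      (bound := fun u => K * ((1 - u) ^ (p - 1) * u ^ (q - 1))) ?_ ?_
      ((intervalIntegrable_beta hp hq).const_mul K) ?_
    · filter_upwards [hnhds] with t ht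
      exact aestronglyMeasurable_convIntegrand hf hg (lt_trans (by positivity) ht.1)
    · filter_upwards [hnhds] with t ht
      have ht0 : 0 < t := lt_trans (by positivity) ht.1
      filter_upwards [ae_uIoc_mem_Ioo] with u hu hu'
      have hu := hu hu'
      have h1u : 0 < 1 - u := sub_pos.2 hu.2
      have e1 := hC (t * (1 - u)) ⟨mul_pos ht0 h1u,
        (mul_le_of_le_one_right ht0.le (by linarith [hu.1])).trans ht.2.le⟩
      have e2 := hD (t * u) ⟨mul_pos ht0 hu.1,
        (mul_le_of_le_one_right ht0.le hu.2.le).trans ht.2.le⟩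
      rw [norm_mul, Real.norm_eq_abs, Real.norm_eq_abs]
      rw [Real.mul_rpow ht0.le h1u.le] at e1
      rw [Real.mul_rpow ht0.le hu.1.le] at e2
      have hb : 0 < (1 - u) ^ (p - 1) * u ^ (q - 1) :=
        mul_pos (Real.rpow_pos_of_pos h1u _) (Real.rpow_pos_of_pos hu.1 _)
      calc |f (t * (1 - u))| * |g (t * u)|
          ≤ C * (t ^ (p - 1) * (1 - u) ^ (p - 1)) * (D * (t ^ (q - 1) * u ^ (q - 1))) :=
            mul_le_mul e1 e2 (abs_nonneg _) ((abs_nonneg _).trans e1)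
        _ = (C * t ^ (p - 1) * (D * t ^ (q - 1))) * ((1 - u) ^ (p - 1) * u ^ (q - 1)) := by ring
        _ ≤ K * ((1 - u) ^ (p - 1) * u ^ (q - 1)) :=
            mul_le_mul_of_nonneg_right ((le_abs_self _).trans (hK t ⟨ht.1.le, ht.2.le⟩)) hb.le
    · filter_upwards [ae_uIoc_mem_Ioo] with u hu hu'
      have hu := hu hu'
      have e1 : 0 < t₀ * (1 - u) := mul_pos ht₀ (sub_pos.2 hu.2)
      have e2 : 0 < t₀ * u := mul_pos ht₀ hu.1
      have c1 : ContinuousAt (fun t => f (t * (1 - u))) t₀ :=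
        ContinuousAt.comp (f := fun t => t * (1 - u)) (hf.continuousAt (Ioi_mem_nhds e1))
          (by fun_prop)
      have c2 : ContinuousAt (fun t => g (t * u)) t₀ :=
        ContinuousAt.comp (f := fun t => t * u) (hg.continuousAt (Ioi_mem_nhds e2))
          (by fun_prop)
      exact c1.mul c2
  refine ContinuousAt.continuousWithinAt ((continuousAt_id.mul hmain).congr ?_)
  filter_upwards [lt_mem_nhds ht₀] with t ht
  exact (halfLineConv_eq_mul_integral f g ht).symm

/-- Fractional integration of a function asymptotic to a power. -/
theorem tendsto_rpow_mul_halfLineConv_fracKernel {S : ℝ → ℝ} {η c K L : ℝ} (hη : η < 1)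
    (hc : 0 < c) (hS : ContinuousOn S (Ioi 0)) (hK : ∀ t, 0 < t → |t ^ η * S t| ≤ K)
    (hL : Tendsto (fun t => t ^ η * S t) atTop (nhds L)) :
    Tendsto (fun t => t ^ (η - c) * halfLineConv (fracKernel c) S t) atTop
      (nhds (L * Real.Gamma (1 - η) / Real.Gamma (c + 1 - η))) := by
  have hη' : 0 < 1 - η := by linarith
  have hΓ := Real.Gamma_pos_of_pos hc
  -- After `s = t u`, `t^(η-c)` times the convolution is this Beta-type integral, with `(t u)^η S(t
  -- u)` tending to `L` for each `u` and bounded by `K`.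
  have hlim : Tendsto (fun t : ℝ => ∫ u in (0 : ℝ)..1, (Real.Gamma c)⁻¹ *
      ((1 - u) ^ (c - 1) * u ^ (1 - η - 1)) * ((t * u) ^ η * S (t * u))) atTop
      (nhds (∫ u in (0 : ℝ)..1, (Real.Gamma c)⁻¹ *
        ((1 - u) ^ (c - 1) * u ^ (1 - η - 1)) * L)) := by
    refine intervalIntegral.tendsto_integral_filter_of_dominated_convergence
      (fun u => (Real.Gamma c)⁻¹ * ((1 - u) ^ (c - 1) * u ^ (1 - η - 1)) * K) ?_ ?_
      (((intervalIntegrable_beta hc hη').const_mul _).mul_const K) ?_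
    · filter_upwards [eventually_gt_atTop 0] with t ht
      rw [uIoc_of_le zero_le_one, ← restrict_Ioo_eq_restrict_Ioc]
      refine ContinuousOn.aestronglyMeasurable (fun u hu => ?_) measurableSet_Ioo
      have h1 : 1 - u ≠ 0 := (sub_pos.2 hu.2).ne'
      have h2 : 0 < t * u := mul_pos ht hu.1
      have c1 : ContinuousAt (fun u : ℝ => (1 - u) ^ (c - 1)) u :=
        (by fun_prop : ContinuousAt (fun u : ℝ => 1 - u) u).rpow_const (Or.inl h1)
      have c2 : ContinuousAt (fun u : ℝ => u ^ (1 - η - 1)) u :=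
        Real.continuousAt_rpow_const _ _ (Or.inl hu.1.ne')
      have c3 : ContinuousAt (fun u : ℝ => (t * u) ^ η) u :=
        (by fun_prop : ContinuousAt (fun u : ℝ => t * u) u).rpow_const (Or.inl h2.ne')
      have c4 : ContinuousAt (fun u : ℝ => S (t * u)) u :=
        ContinuousAt.comp (f := fun u => t * u) (hS.continuousAt (Ioi_mem_nhds h2))
          (by fun_prop)
      exact (((c1.mul c2).const_mul _).mul (c3.mul c4)).continuousWithinAt
    · filter_upwards [eventually_gt_atTop 0] with t ht
      filter_upwards [ae_uIoc_mem_Ioo] with u hu hu'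
      have hu := hu hu'
      have h1u : 0 < 1 - u := sub_pos.2 hu.2
      have hpos : 0 < (Real.Gamma c)⁻¹ * ((1 - u) ^ (c - 1) * u ^ (1 - η - 1)) :=
        mul_pos (inv_pos.2 hΓ) (mul_pos (Real.rpow_pos_of_pos h1u _)
          (Real.rpow_pos_of_pos hu.1 _))
      rw [norm_mul, Real.norm_of_nonneg hpos.le]
      exact mul_le_mul_of_nonneg_left (hK _ (mul_pos ht hu.1)) hpos.le
    · filter_upwards [ae_uIoc_mem_Ioo] with u hu hu'
      have hu := hu hu'
      exact (hL.comp (tendsto_id.atTop_mul_const hu.1)).const_mul _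
  rw [intervalIntegral.integral_mul_const, intervalIntegral.integral_const_mul,
    integral_beta hc hη'] at hlim
  have hval : (Real.Gamma c)⁻¹ * (Real.Gamma c * Real.Gamma (1 - η) /
      Real.Gamma (c + (1 - η))) * L = L * Real.Gamma (1 - η) / Real.Gamma (c + 1 - η) := by
    rw [add_sub_assoc]
    field_simp
  rw [hval] at hlim
  refine hlim.congr' ?_
  filter_upwards [eventually_gt_atTop 0] with t ht
  rw [halfLineConv_eq_mul_integral _ _ ht, ← mul_assoc,
    ← intervalIntegral.integral_const_mul]
  refine intervalIntegral.integral_congr_ae ?_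
  filter_upwards [ae_uIoc_mem_Ioo] with u hu hu'
  have hu := hu hu'
  have h1u : 0 < 1 - u := sub_pos.2 hu.2
  rw [fracKernel, Real.mul_rpow ht.le h1u.le, Real.mul_rpow ht.le hu.1.le]
  have e1 : u ^ (1 - η - 1) * u ^ η = 1 := by
    rw [← Real.rpow_add hu.1]
    simp
  have e2 : t ^ (η - c) * t * t ^ (c - 1) = t ^ η := by
    rw [← Real.rpow_add_one ht.ne', ← Real.rpow_add ht]
    ring_nf
  linear_combination (Real.Gamma c)⁻¹ * (1 - u) ^ (c - 1) * S (t * u) * (t ^ η * e1 - e2)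

/-! ### Positivity of resolvents of log-convex kernels. -/

/-- The first factor is singular only at `s = t`, the second only at `s = 0`; cutting at `t / 2`
leaves one continuous factor on each half. -/
theorem intervalIntegrable_convIntegrand {k r : ℝ → ℝ} {t : ℝ} (ht : 0 < t)
    (hk : ContinuousOn k (Ioi 0)) (hr : ContinuousOn r (Ioi 0))
    (hki : ∀ T, 0 ≤ T → IntervalIntegrable k volume 0 T)
    (hri : ∀ T, 0 ≤ T → IntervalIntegrable r volume 0 T) :
    IntervalIntegrable (fun s => k (t - s) * r s) volume 0 t := by
  have ht2 : 0 ≤ t / 2 := by positivity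
  refine IntervalIntegrable.trans (b := t / 2) ?_ ?_
  · refine (hri _ ht2).continuousOn_mul (hk.comp (by fun_prop) fun s hs => ?_)
    rw [uIcc_of_le ht2] at hs
    exact mem_Ioi.2 (by linarith [hs.2])
  · have h1 : IntervalIntegrable (fun s => k (t - s)) volume (t / 2) t := by
      have h := ((hki (t / 2) ht2).comp_sub_left t).symm
      rwa [sub_zero, sub_half] at h
    refine h1.mul_continuousOn (hr.mono fun s hs => ?_)
    rw [uIcc_of_le (by linarith)] at hs
    exact mem_Ioi.2 (by linarith [hs.1])

/-- The resolvent of a positive, nonincreasing and log-convex kernel is positive. -/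
theorem pos_of_add_halfLineConv_eq {k r : ℝ → ℝ}
    (hk : ContinuousOn k (Ioi 0)) (hkpos : ∀ t, 0 < t → 0 < k t) (hanti : AntitoneOn k (Ioi 0))
    (hlc : ∀ x y h, 0 < x → x ≤ y → 0 ≤ h → k (x + h) * k y ≤ k (y + h) * k x)
    (hki : ∀ T, 0 ≤ T → IntervalIntegrable k volume 0 T)
    (hr : ContinuousOn r (Ioi 0)) (hri : ∀ T, 0 ≤ T → IntervalIntegrable r volume 0 T)
    (heq : ∀ t, 0 < t → r t + halfLineConv k r t = k t)
    {ε : ℝ} (hε : 0 < ε) (hr0 : ∀ t ∈ Ioo 0 ε, 0 < r t) : ∀ t, 0 < t → 0 < r t := by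
  by_contra! hne
  set Z : Set ℝ := {t | 0 < t ∧ r t ≤ 0} with hZ
  have hZne : Z.Nonempty := hne
  have hZlow : ∀ t ∈ Z, ε ≤ t := fun t ht => by
    by_contra! h
    exact absurd (hr0 t ⟨ht.1, h⟩) (not_lt.2 ht.2)
  have hZb : BddBelow Z := ⟨ε, hZlow⟩
  set t₀ := sInf Z
  have ht₀ : 0 < t₀ := hε.trans_le (le_csInf hZne hZlow)
  have hrt₀ : r t₀ ≤ 0 := by
    have h1 : t₀ ∈ closure Z := csInf_mem_closure hZne hZb
    by_contra! h
    have h2 := (hr.continuousAt (Ioi_mem_nhds ht₀)).eventually_const_lt h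
    obtain ⟨t, h3, h4⟩ := mem_closure_iff_nhds.1 h1 _ h2
    exact absurd h3 (not_lt.2 h4.2)
  have hpos : ∀ t, 0 < t → t < t₀ → 0 < r t := fun t h1 h2 => by
    by_contra! h
    exact absurd (csInf_le hZb ⟨h1, h⟩) (not_le.2 h2)
  have hc : 0 < k t₀ / k (t₀ / 2) := div_pos (hkpos _ ht₀) (hkpos _ (by positivity))
  -- At `t₀`, the first point where `r ≤ 0`, a contradiction is sought. `δ` makes the contribution
  -- of the last stretch of the convolution small; `δ < t₀/2` keeps the point `t` chosen next above
  -- `t₀/2`, so that `k t ≤ k (t₀/2)`.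
  obtain ⟨δ, hδ0, hδ1, hδ⟩ : ∃ δ, 0 < δ ∧ δ < t₀ / 2 ∧
      ∫ s in (0 : ℝ)..δ, k s < k t₀ / k (t₀ / 2) := by
    have hcont : ContinuousOn (fun x => ∫ s in (0 : ℝ)..x, k s) (uIcc 0 1) := by
      refine intervalIntegral.continuousOn_primitive_interval ?_
      rw [uIcc_of_le zero_le_one, integrableOn_Icc_iff_integrableOn_Ioc]
      exact (intervalIntegrable_iff_integrableOn_Ioc_of_le zero_le_one).1 (hki 1 zero_le_one)
    have h1 := hcont 0 (by simp)
    rw [ContinuousWithinAt, intervalIntegral.integral_same, uIcc_of_le zero_le_one] at h1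
    have h2 := (h1.mono_left (nhdsWithin_mono 0 (s := Ioo 0 1) Ioo_subset_Icc_self))
    rw [nhdsWithin_Ioo_eq_nhdsGT zero_lt_one] at h2
    have h3 := h2.eventually_lt_const hc
    have h4 : ∀ᶠ x : ℝ in nhdsWithin 0 (Ioi 0), x < t₀ / 2 :=
      nhdsWithin_le_nhds (gt_mem_nhds (by positivity))
    obtain ⟨δ, ⟨h5, h6⟩, h7⟩ := ((h3.and h4).and self_mem_nhdsWithin).exists
    exact ⟨δ, h7, h6, h5⟩
  -- Splitting at a maximum point `t` of `r` on the window bounds `r` on `[t, t₀]` by `r t`; and `t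
  -- < t₀` because `r t > 0 ≥ r t₀`.
  obtain ⟨t, ⟨htl, htu⟩, hmax⟩ := isCompact_Icc.exists_isMaxOn (s := Icc (t₀ - δ) t₀)
    ⟨t₀, by linarith, le_rfl⟩ (hr.mono fun x hx => mem_Ioi.2 (by linarith [hx.1]))
  have hrt : 0 < r t := (hpos (t₀ - δ) (by linarith) (by linarith)).trans_le
    (hmax ⟨le_rfl, by linarith⟩)
  have htlt : t < t₀ := lt_of_le_of_ne htu fun h => by
    rw [h] at hrt
    exact absurd hrt (not_lt.2 hrt₀)
  have ht0 : 0 < t := by linarith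
  have hint := intervalIntegrable_convIntegrand ht₀ hk hr hki hri
  have hi1 : IntervalIntegrable (fun s => k (t₀ - s) * r s) volume 0 t :=
    hint.mono_set (by
      rw [uIcc_of_le ht0.le, uIcc_of_le ht₀.le]
      exact Icc_subset_Icc_right htu)
  have hi2 : IntervalIntegrable (fun s => k (t₀ - s) * r s) volume t t₀ :=
    hint.mono_set (by
      rw [uIcc_of_le htu, uIcc_of_le ht₀.le]
      exact Icc_subset_Icc_left ht0.le)
  -- Log-convexity gives `k (t₀ - s) ≤ (k t₀ / k t) k (t - s)`, and the equation at `t` evaluates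
  -- the remaining integral. This leaves a surplus `(k t₀ / k t) r t`, which exceeds the
  -- contribution of `[t, t₀]` and forces `r t₀ > 0`.
  have hb1 : ∫ s in (0 : ℝ)..t, k (t₀ - s) * r s ≤ k t₀ / k t * (k t - r t) := by
    have e : k t - r t = ∫ s in (0 : ℝ)..t, k (t - s) * r s := by
      have := heq t ht0
      rw [halfLineConv] at this
      linarith
    rw [e, ← intervalIntegral.integral_const_mul]
    refine intervalIntegral.integral_mono_on_of_le_Ioo ht0.le hi1
      ((intervalIntegrable_convIntegrand ht0 hk hr hki hri).const_mul _) fun s hs => ?_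
    have h1 := hlc (t - s) t (t₀ - t) (sub_pos.2 hs.2) (by linarith [hs.1]) (by linarith)
    have e1 : t - s + (t₀ - t) = t₀ - s := by ring
    have e2 : t + (t₀ - t) = t₀ := by ring
    rw [e1, e2] at h1
    rw [← mul_assoc]
    refine mul_le_mul_of_nonneg_right ?_ (hpos s hs.1 (hs.2.trans htlt)).le
    rw [div_mul_eq_mul_div, le_div_iff₀ (hkpos t ht0)]
    exact h1
  have hik : IntervalIntegrable (fun s => k (t₀ - s)) volume t t₀ := by
    have h := ((hki (t₀ - t) (by linarith)).comp_sub_left t₀).symm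
    rwa [sub_zero, sub_sub_cancel] at h
  have hb2 : ∫ s in t..t₀, k (t₀ - s) * r s ≤ (∫ s in (0 : ℝ)..δ, k s) * r t := by
    calc ∫ s in t..t₀, k (t₀ - s) * r s ≤ ∫ s in t..t₀, k (t₀ - s) * r t := by
          refine intervalIntegral.integral_mono_on_of_le_Ioo htu hi2 (hik.mul_const _)
            fun s hs => ?_
          exact mul_le_mul_of_nonneg_left (hmax ⟨by linarith [hs.1], hs.2.le⟩)
            (hkpos _ (sub_pos.2 hs.2)).le
      _ = (∫ s in (0 : ℝ)..(t₀ - t), k s) * r t := by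
          rw [intervalIntegral.integral_mul_const, intervalIntegral.integral_comp_sub_left
            (fun s => k s), sub_self]
      _ ≤ (∫ s in (0 : ℝ)..δ, k s) * r t := by
          refine mul_le_mul_of_nonneg_right ?_ hrt.le
          refine intervalIntegral.integral_mono_interval le_rfl (by linarith) (by linarith) ?_
            (hki δ hδ0.le)
          filter_upwards [ae_restrict_mem measurableSet_Ioc] with s hs
          exact (hkpos s hs.1).le
  have hsplit := intervalIntegral.integral_add_adjacent_intervals hi1 hi2
  have hkt : k t₀ / k (t₀ / 2) ≤ k t₀ / k t :=
    div_le_div_of_nonneg_left (hkpos _ ht₀).le (hkpos t ht0)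
      (hanti (mem_Ioi.2 (by positivity)) ht0 (by linarith))
  have hfin : (∫ s in (0 : ℝ)..δ, k s) * r t < k t₀ / k t * r t :=
    mul_lt_mul_of_pos_right (hδ.trans_le hkt) hrt
  have h1 := heq t₀ ht₀
  rw [halfLineConv] at h1
  have h2 : k t₀ / k t * k t = k t₀ := div_mul_cancel₀ _ (hkpos t ht0).ne'
  have h3 : k t₀ / k t * (k t - r t) = k t₀ - k t₀ / k t * r t := by
    rw [mul_sub, h2]
  linarith

/-! ### Small-time bounds and the kernel `β₁ g_{α₁} + β₂ g_{α₂}`. -/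

/-- The Beta integral adds the exponents, so convolution softens the singularity at `0`. This makes
`k * r` negligible against `k` for small times. -/
theorem abs_halfLineConv_le {f g : ℝ → ℝ} {p q C D T : ℝ} (hp : 0 < p) (hq : 0 < q)
    (hf : ∀ t ∈ Ioc 0 T, |f t| ≤ C * t ^ (p - 1)) (hg : ∀ t ∈ Ioc 0 T, |g t| ≤ D * t ^ (q - 1))
    {t : ℝ} (ht : t ∈ Ioc 0 T) :
    |halfLineConv f g t| ≤
      C * D * (Real.Gamma p * Real.Gamma q / Real.Gamma (p + q)) * t ^ (p + q - 1) := by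
  have ht0 : 0 < t := ht.1
  rw [halfLineConv_eq_mul_integral _ _ ht0, abs_mul, abs_of_pos ht0, ← integral_beta hp hq]
  have h : |∫ u in (0 : ℝ)..1, f (t * (1 - u)) * g (t * u)| ≤
      ∫ u in (0 : ℝ)..1, C * D * t ^ (p - 1) * t ^ (q - 1) *
        ((1 - u) ^ (p - 1) * u ^ (q - 1)) := by
    rw [← Real.norm_eq_abs]
    refine intervalIntegral.norm_integral_le_of_norm_le zero_le_one ?_
      ((intervalIntegrable_beta hp hq).const_mul _)
    filter_upwards [ae_uIoc_mem_Ioo] with u hu hu'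
    have hu := hu (by rwa [uIoc_of_le zero_le_one])
    have h1u : 0 < 1 - u := sub_pos.2 hu.2
    have e1 := hf (t * (1 - u)) ⟨mul_pos ht0 h1u,
      (mul_le_of_le_one_right ht0.le (by linarith [hu.1])).trans ht.2⟩
    have e2 := hg (t * u) ⟨mul_pos ht0 hu.1,
      (mul_le_of_le_one_right ht0.le hu.2.le).trans ht.2⟩
    rw [norm_mul, Real.norm_eq_abs, Real.norm_eq_abs]
    rw [Real.mul_rpow ht0.le h1u.le] at e1
    rw [Real.mul_rpow ht0.le hu.1.le] at e2
    calc |f (t * (1 - u))| * |g (t * u)|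
        ≤ C * (t ^ (p - 1) * (1 - u) ^ (p - 1)) * (D * (t ^ (q - 1) * u ^ (q - 1))) :=
          mul_le_mul e1 e2 (abs_nonneg _) ((abs_nonneg _).trans e1)
      _ = _ := by ring
  rw [intervalIntegral.integral_const_mul] at h
  have e : t ^ (p + q - 1) = t * (t ^ (p - 1) * t ^ (q - 1)) := by
    rw [← Real.rpow_add ht0, mul_comm, ← Real.rpow_add_one ht0.ne']
    ring_nf
  rw [e]
  calc _ ≤ t * _ := mul_le_mul_of_nonneg_left h ht0.le
    _ = _ := by ring

theorem rpow_logConvex {q x y h : ℝ} (hq : q ≤ 0) (hx : 0 < x) (hxy : x ≤ y) (hh : 0 ≤ h) :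
    (x + h) ^ q * y ^ q ≤ (y + h) ^ q * x ^ q := by
  have hy : 0 < y := hx.trans_le hxy
  rw [← Real.mul_rpow (by positivity) hy.le, ← Real.mul_rpow (by positivity) hx.le]
  refine Real.rpow_le_rpow_of_nonpos (by positivity) ?_ hq
  nlinarith

/-- The kernel `β₁ g_{α₁} + β₂ g_{α₂}`. -/
noncomputable def mixedFracKernel (α₁ β₁ α₂ β₂ t : ℝ) : ℝ :=
  β₁ * fracKernel α₁ t + β₂ * fracKernel α₂ t

/-- The Laplace transform of the kernel `β₁ g_{α₁} + β₂ g_{α₂}`. -/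
noncomputable def mixedSymbol (α₁ β₁ α₂ β₂ s : ℝ) : ℝ :=
  β₁ * s ^ (-α₁) + β₂ * s ^ (-α₂)

/-- The resolvent of the kernel `β₁ g_{α₁} + β₂ g_{α₂}`. -/
noncomputable def mixedFracResolvent (α₁ β₁ α₂ β₂ : ℝ) : ℝ → ℝ :=
  fracResolvent (fun j : Bool => cond j β₁ β₂) (fun j : Bool => cond j α₁ α₂)

section MixedKernel

variable {α₁ α₂ β₁ β₂ : ℝ}

theorem mixedSymbol_pos (hβ₁ : 0 < β₁) (hβ₂ : 0 < β₂) {s : ℝ} (hs : 0 < s) :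
    0 < mixedSymbol α₁ β₁ α₂ β₂ s :=
  add_pos (mul_pos hβ₁ (Real.rpow_pos_of_pos hs _)) (mul_pos hβ₂ (Real.rpow_pos_of_pos hs _))

theorem exists_mixedSymbol_lt_one (hα₁ : 0 < α₁) (hα₂ : 0 < α₂) :
    ∃ σ, 0 < σ ∧ ∀ s, σ ≤ s → mixedSymbol α₁ β₁ α₂ β₂ s < 1 := by
  have h : Tendsto (mixedSymbol α₁ β₁ α₂ β₂) atTop (nhds (β₁ * 0 + β₂ * 0)) :=
    ((tendsto_rpow_neg_atTop hα₁).const_mul β₁).add ((tendsto_rpow_neg_atTop hα₂).const_mul β₂)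
  simp only [mul_zero, add_zero] at h
  obtain ⟨σ, hσ⟩ := eventually_atTop.1 (h.eventually_lt_const one_pos)
  exact ⟨max σ 1, lt_max_of_lt_right one_pos, fun s hs => hσ s ((le_max_left _ _).trans hs)⟩

theorem laplaceIntegrable_mixedFracKernel (hα₁ : 0 < α₁) (hα₂ : 0 < α₂) {s : ℝ} (hs : 0 < s) :
    LaplaceIntegrable s (mixedFracKernel α₁ β₁ α₂ β₂) :=
  ((laplaceIntegrable_fracKernel hα₁ hs).const_mul β₁).add
    ((laplaceIntegrable_fracKernel hα₂ hs).const_mul β₂)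

theorem laplace_mixedFracKernel (hα₁ : 0 < α₁) (hα₂ : 0 < α₂) {s : ℝ} (hs : 0 < s) :
    laplace (mixedFracKernel α₁ β₁ α₂ β₂) s = mixedSymbol α₁ β₁ α₂ β₂ s := by
  have h := laplace_add ((laplaceIntegrable_fracKernel hα₁ hs).const_mul β₁)
    ((laplaceIntegrable_fracKernel hα₂ hs).const_mul β₂)
  rw [laplace_const_mul, laplace_const_mul, laplace_fracKernel hα₁ hs,
    laplace_fracKernel hα₂ hs] at h
  exact h

theorem continuousOn_mixedFracKernel : ContinuousOn (mixedFracKernel α₁ β₁ α₂ β₂) (Ioi 0) :=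
  ((continuousOn_fracKernel α₁).const_mul β₁).add ((continuousOn_fracKernel α₂).const_mul β₂)

theorem mixedFracKernel_pos (hα₁ : 0 < α₁) (hα₂ : 0 < α₂) (hβ₁ : 0 < β₁) (hβ₂ : 0 < β₂)
    {t : ℝ} (ht : 0 < t) : 0 < mixedFracKernel α₁ β₁ α₂ β₂ t :=
  add_pos (mul_pos hβ₁ (fracKernel_pos hα₁ ht)) (mul_pos hβ₂ (fracKernel_pos hα₂ ht))

theorem antitoneOn_fracKernel {c : ℝ} (hc : 0 < c) (hc1 : c ≤ 1) :
    AntitoneOn (fracKernel c) (Ioi 0) := fun _ hx _ _ hxy =>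
  div_le_div_of_nonneg_right (Real.rpow_le_rpow_of_nonpos hx hxy (by linarith))
    (Real.Gamma_pos_of_pos hc).le

theorem antitoneOn_mixedFracKernel (hα₁ : 0 < α₁) (hα₂ : 0 < α₂) (hα₁' : α₁ ≤ 1) (hα₂' : α₂ ≤ 1)
    (hβ₁ : 0 < β₁) (hβ₂ : 0 < β₂) : AntitoneOn (mixedFracKernel α₁ β₁ α₂ β₂) (Ioi 0) :=
  fun _ hx _ hy hxy => add_le_add
    (mul_le_mul_of_nonneg_left (antitoneOn_fracKernel hα₁ hα₁' hx hy hxy) hβ₁.le)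
    (mul_le_mul_of_nonneg_left (antitoneOn_fracKernel hα₂ hα₂' hx hy hxy) hβ₂.le)

/-- Factoring out `t^(α₂-1)` leaves `c t^(α₁-α₂) + d`. Log-convexity of that sum needs, besides
log-convexity of the power, its ordinary convexity for the cross terms. -/
theorem mixedFracKernel_logConvex (hα₁ : 0 < α₁) (hα : α₁ ≤ α₂) (hα₂ : α₂ < 1)
    (hβ₁ : 0 < β₁) (hβ₂ : 0 < β₂) (x y h : ℝ) (hx : 0 < x) (hxy : x ≤ y) (hh : 0 ≤ h) :
    mixedFracKernel α₁ β₁ α₂ β₂ (x + h) * mixedFracKernel α₁ β₁ α₂ β₂ y ≤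
      mixedFracKernel α₁ β₁ α₂ β₂ (y + h) * mixedFracKernel α₁ β₁ α₂ β₂ x := by
  have hΓ₁ := Real.Gamma_pos_of_pos hα₁
  have hΓ₂ := Real.Gamma_pos_of_pos (hα₁.trans_le hα)
  set c := β₁ / Real.Gamma α₁
  set d := β₂ / Real.Gamma α₂
  have hc : 0 < c := div_pos hβ₁ hΓ₁
  have hd : 0 < d := div_pos hβ₂ hΓ₂
  have hfac : ∀ t, 0 < t → mixedFracKernel α₁ β₁ α₂ β₂ t =
      t ^ (α₂ - 1) * (c * t ^ (α₁ - α₂) + d) := by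
    intro t ht
    have e : t ^ (α₁ - 1) = t ^ (α₂ - 1) * t ^ (α₁ - α₂) := by
      rw [← Real.rpow_add ht]
      ring_nf
    rw [mixedFracKernel, fracKernel, fracKernel, e]
    ring
  have hy : 0 < y := hx.trans_le hxy
  have hδ : α₁ - α₂ ≤ 0 := by linarith
  have h1 := rpow_logConvex (q := α₂ - 1) (by linarith) hx hxy hh
  have h2 := rpow_logConvex hδ hx hxy hh
  rw [hfac _ (by positivity), hfac y hy, hfac _ (by positivity), hfac x hx]
  have px := Real.rpow_pos_of_pos hx (α₁ - α₂)
  have py := Real.rpow_pos_of_pos hy (α₁ - α₂)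
  have pxh := Real.rpow_pos_of_pos (by positivity : 0 < x + h) (α₁ - α₂)
  have pyh := Real.rpow_pos_of_pos (by positivity : 0 < y + h) (α₁ - α₂)
  have qx := Real.rpow_pos_of_pos hx (α₂ - 1)
  have qy := Real.rpow_pos_of_pos hy (α₂ - 1)
  have qxh := Real.rpow_pos_of_pos (by positivity : 0 < x + h) (α₂ - 1)
  have qyh := Real.rpow_pos_of_pos (by positivity : 0 < y + h) (α₂ - 1)
  have m1 : y ^ (α₁ - α₂) ≤ x ^ (α₁ - α₂) := Real.rpow_le_rpow_of_nonpos hx hxy hδ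
  have m2 : (x + h) ^ (α₁ - α₂) ≤ x ^ (α₁ - α₂) :=
    Real.rpow_le_rpow_of_nonpos hx (by linarith) hδ
  generalize x ^ (α₁ - α₂) = a at *
  generalize y ^ (α₁ - α₂) = b at *
  generalize (x + h) ^ (α₁ - α₂) = a' at *
  generalize (y + h) ^ (α₁ - α₂) = b' at *
  -- Convexity from log-convexity: `a (a' + b) ≤ a² + a' b ≤ a² + b' a`, the first step being `(a -
  -- a')(a - b) ≥ 0`.
  have h3 : a' + b ≤ b' + a := by
    have : 0 ≤ (a - a') * (a - b) := mul_nonneg (by linarith) (by linarith)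
    have h4 : a * (a' + b) ≤ a * (b' + a) := by nlinarith
    exact le_of_mul_le_mul_left h4 px
  have h4 : (c * a' + d) * (c * b + d) ≤ (c * b' + d) * (c * a + d) := by
    have e1 := mul_le_mul_of_nonneg_left h2 (mul_pos hc hc).le
    have e2 := mul_le_mul_of_nonneg_left h3 (mul_pos hc hd).le
    linarith
  have h5 := mul_le_mul h1 h4 (by positivity) (by positivity)
  linarith

theorem abs_fracKernel_le {c p : ℝ} (hc : 0 < c) (hp : p ≤ c) {T : ℝ} :
    ∀ t ∈ Ioc 0 T, |fracKernel c t| ≤ T ^ (c - p) / Real.Gamma c * t ^ (p - 1) := by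
  intro t ht
  have ht0 : 0 < t := ht.1
  rw [abs_of_pos (fracKernel_pos hc ht0), fracKernel, div_mul_eq_mul_div]
  refine div_le_div_of_nonneg_right ?_ (Real.Gamma_pos_of_pos hc).le
  have e : t ^ (c - 1) = t ^ (c - p) * t ^ (p - 1) := by
    rw [← Real.rpow_add ht0]
    ring_nf
  rw [e]
  gcongr
  exact ht.2

theorem abs_mixedFracKernel_le (hα₁ : 0 < α₁) (hα : α₁ ≤ α₂) (T : ℝ) (_ : 0 < T) :
    ∃ C, ∀ t ∈ Ioc 0 T, |mixedFracKernel α₁ β₁ α₂ β₂ t| ≤ C * t ^ (α₁ - 1) := by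
  refine ⟨|β₁| * (T ^ (α₁ - α₁) / Real.Gamma α₁) + |β₂| * (T ^ (α₂ - α₁) / Real.Gamma α₂),
    fun t ht => ?_⟩
  refine (abs_add_le _ _).trans ?_
  rw [abs_mul, abs_mul, add_mul, mul_assoc, mul_assoc]
  exact add_le_add
    (mul_le_mul_of_nonneg_left (abs_fracKernel_le hα₁ le_rfl t ht) (abs_nonneg _))
    (mul_le_mul_of_nonneg_left (abs_fracKernel_le (hα₁.trans_le hα) hα t ht) (abs_nonneg _))

end MixedKernel

/-! ### The resolvent `r` of the mixed kernel. -/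

section MixedResolvent

variable {α₁ α₂ β₁ β₂ : ℝ} (hα₁ : 0 < α₁) (hα : α₁ ≤ α₂) (hα₂ : α₂ < 1)
  (hβ₁ : 0 < β₁) (hβ₂ : 0 < β₂)
include hα₁ hα hβ₁ hβ₂

theorem laplace_mixedFracResolvent_of_lt_one {s : ℝ} (hs : 0 < s)
    (h : mixedSymbol α₁ β₁ α₂ β₂ s < 1) :
    LaplaceIntegrable s (mixedFracResolvent α₁ β₁ α₂ β₂) ∧
      laplace (mixedFracResolvent α₁ β₁ α₂ β₂) s =
        mixedSymbol α₁ β₁ α₂ β₂ s / (1 + mixedSymbol α₁ β₁ α₂ β₂ s) := by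
  have hα₂0 := hα₁.trans_le hα
  have h1 := laplace_fracResolvent (b := fun j : Bool => cond j β₁ β₂)
    (a := fun j : Bool => cond j α₁ α₂) (s := s)
    (by simp [hβ₁.le, hβ₂.le]) (by simp [hα₁, hα₂0]) hs
    (by simpa [mixedSymbol] using h)
  simpa [mixedSymbol, mixedFracResolvent] using h1

theorem exists_summable_mixedFracResolvent :
    ∃ σ : ℝ, 0 < σ ∧ Summable fun p : Σ n : ℕ, Fin (n + 1) → Bool =>
      |-∏ i, -(cond (p.2 i) β₁ β₂)| * σ ^ (-∑ i, cond (p.2 i) α₁ α₂) := by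
  obtain ⟨σ, hσ, h⟩ := exists_mixedSymbol_lt_one (β₁ := β₁) (β₂ := β₂) hα₁ (hα₁.trans_le hα)
  refine ⟨σ, hσ, summable_fracResolvent (b := fun j : Bool => cond j β₁ β₂)
    (a := fun j : Bool => cond j α₁ α₂) (by simp [hβ₁.le, hβ₂.le]) hσ ?_⟩
  simpa [mixedSymbol] using h σ le_rfl

omit hβ₁ hβ₂ in
theorem le_sum_word (p : Σ n : ℕ, Fin (n + 1) → Bool) : α₁ ≤ ∑ i, cond (p.2 i) α₁ α₂ := by
  have hj : ∀ j : Bool, α₁ ≤ cond j α₁ α₂ := by simp [hα]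
  exact (hj (p.2 0)).trans (Finset.single_le_sum (f := fun i => cond (p.2 i) α₁ α₂)
    (fun i _ => hα₁.le.trans (hj _)) (Finset.mem_univ 0))

theorem continuousOn_mixedFracResolvent :
    ContinuousOn (mixedFracResolvent α₁ β₁ α₂ β₂) (Ioi 0) := by
  obtain ⟨σ, hσ, h⟩ := exists_summable_mixedFracResolvent hα₁ hα hβ₁ hβ₂
  exact continuousOn_fracSeries hσ (fun p => hα₁.trans_le (le_sum_word hα₁ hα p)) h

theorem abs_mixedFracResolvent_le (T : ℝ) (hT : 0 < T) :
    ∃ C, ∀ t ∈ Ioc 0 T, |mixedFracResolvent α₁ β₁ α₂ β₂ t| ≤ C * t ^ (α₁ - 1) := by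
  obtain ⟨σ, hσ, h⟩ := exists_summable_mixedFracResolvent hα₁ hα hβ₁ hβ₂
  exact abs_fracSeries_le hσ (fun p => hα₁.trans_le (le_sum_word hα₁ hα p)) h
    (le_sum_word hα₁ hα) hT

/-- The transforms agree for large `s`, so the equation holds almost everywhere; continuity of both
sides makes it hold at every `t > 0`, as the positivity argument requires. -/
theorem mixedFracResolvent_add_halfLineConv (t : ℝ) (ht : 0 < t) :
    mixedFracResolvent α₁ β₁ α₂ β₂ t +
      halfLineConv (mixedFracKernel α₁ β₁ α₂ β₂) (mixedFracResolvent α₁ β₁ α₂ β₂) t =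
      mixedFracKernel α₁ β₁ α₂ β₂ t := by
  have hα₂0 := hα₁.trans_le hα
  obtain ⟨σ, hσ, h⟩ := exists_mixedSymbol_lt_one (β₁ := β₁) (β₂ := β₂) hα₁ hα₂0
  have hr := fun s (hs : σ ≤ s) => laplace_mixedFracResolvent_of_lt_one hα₁ hα hβ₁ hβ₂
    (hσ.trans_le hs) (h s hs)
  have hk := fun s (hs : σ ≤ s) => laplaceIntegrable_mixedFracKernel (β₁ := β₁) (β₂ := β₂)
    hα₁ hα₂0 (hσ.trans_le hs)
  have hae := ae_eq_of_laplace_eq ((hr σ le_rfl).1.add ((hk σ le_rfl).halfLineConv (hr σ le_rfl).1))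
    (hk σ le_rfl) fun s hs => by
      have hs0 := hσ.trans_le hs
      rw [laplace_add (hr s hs).1 ((hk s hs).halfLineConv (hr s hs).1),
        laplace_halfLineConv (hk s hs) (hr s hs).1, (hr s hs).2,
        laplace_mixedFracKernel hα₁ hα₂0 hs0]
      have hpos := mixedSymbol_pos (α₁ := α₁) (α₂ := α₂) hβ₁ hβ₂ hs0
      field_simp
  have hr' := continuousOn_mixedFracResolvent hα₁ hα hβ₁ hβ₂
  exact Measure.eqOn_open_of_ae_eq hae isOpen_Ioi
    (hr'.add (continuousOn_halfLineConv hα₁ hα₁ continuousOn_mixedFracKernel hr'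
      (abs_mixedFracKernel_le hα₁ hα) (abs_mixedFracResolvent_le hα₁ hα hβ₁ hβ₂)))
    continuousOn_mixedFracKernel ht

include hα₂

theorem mixedFracResolvent_pos (t : ℝ) (ht : 0 < t) : 0 < mixedFracResolvent α₁ β₁ α₂ β₂ t := by
  have hα₂0 := hα₁.trans_le hα
  obtain ⟨σ, hσ, h⟩ := exists_mixedSymbol_lt_one (β₁ := β₁) (β₂ := β₂) hα₁ hα₂0
  obtain ⟨C, hC⟩ := abs_mixedFracKernel_le (β₁ := β₁) (β₂ := β₂) hα₁ hα 1 one_pos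
  obtain ⟨D, hD⟩ := abs_mixedFracResolvent_le hα₁ hα hβ₁ hβ₂ 1 one_pos
  set B := C * D * (Real.Gamma α₁ * Real.Gamma α₁ / Real.Gamma (α₁ + α₁))
  set c := β₁ / Real.Gamma α₁
  have hc : 0 < c := div_pos hβ₁ (Real.Gamma_pos_of_pos hα₁)
  -- Near `0` the kernel exceeds `c t^(α₁-1)` while `k * r` is at most `B t^(2α₁-1)`; below `ε` the
  -- former wins, which starts the positivity argument.
  obtain ⟨ε, hε, hsmall⟩ : ∃ ε, 0 < ε ∧ ∀ t ∈ Ioo 0 ε, t ≤ 1 ∧ B * t ^ α₁ < c := by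
    have h1 : Tendsto (fun t : ℝ => B * t ^ α₁) (nhds 0) (nhds (B * 0 ^ α₁)) :=
      ((Real.continuousAt_rpow_const 0 α₁ (Or.inr hα₁.le)).const_mul B).tendsto
    rw [Real.zero_rpow hα₁.ne', mul_zero] at h1
    obtain ⟨ε, hε, hb⟩ := Metric.eventually_nhds_iff.1 (h1.eventually_lt_const hc)
    refine ⟨min ε 1, lt_min hε one_pos, fun t ht => ⟨(ht.2.trans_le (min_le_right _ _)).le,
      hb ?_⟩⟩
    rw [Real.dist_eq, sub_zero, abs_of_pos ht.1]
    exact ht.2.trans_le (min_le_left _ _)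
  refine pos_of_add_halfLineConv_eq continuousOn_mixedFracKernel
    (fun t ht => mixedFracKernel_pos hα₁ hα₂0 hβ₁ hβ₂ ht)
    (antitoneOn_mixedFracKernel hα₁ hα₂0 (by linarith) hα₂.le hβ₁ hβ₂)
    (mixedFracKernel_logConvex hα₁ hα hα₂ hβ₁ hβ₂)
    (laplaceIntegrable_mixedFracKernel hα₁ hα₂0 one_pos).intervalIntegrable
    (continuousOn_mixedFracResolvent hα₁ hα hβ₁ hβ₂)
    (laplace_mixedFracResolvent_of_lt_one hα₁ hα hβ₁ hβ₂ hσ (h σ le_rfl)).1.intervalIntegrable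
    (mixedFracResolvent_add_halfLineConv hα₁ hα hβ₁ hβ₂) hε (fun t ht => ?_) t ht
  have ht0 : 0 < t := ht.1
  obtain ⟨ht1, hBt⟩ := hsmall t ht
  have e1 := mixedFracResolvent_add_halfLineConv hα₁ hα hβ₁ hβ₂ t ht0
  have e2 := (le_abs_self _).trans (abs_halfLineConv_le hα₁ hα₁ hC hD ⟨ht0, ht1⟩)
  have e3 : t ^ (α₁ + α₁ - 1) = t ^ α₁ * t ^ (α₁ - 1) := by
    rw [← Real.rpow_add ht0]
    ring_nf
  rw [e3] at e2
  have e4 : c * t ^ (α₁ - 1) < mixedFracKernel α₁ β₁ α₂ β₂ t := by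
    rw [mixedFracKernel, fracKernel, ← mul_div_assoc, mul_div_right_comm]
    exact lt_add_of_pos_right _ (mul_pos hβ₂ (fracKernel_pos hα₂0 ht0))
  have e5 := mul_lt_mul_of_pos_right hBt (Real.rpow_pos_of_pos ht0 (α₁ - 1))
  linarith

theorem mixedFracResolvent_le (t : ℝ) (ht : 0 < t) :
    mixedFracResolvent α₁ β₁ α₂ β₂ t ≤ mixedFracKernel α₁ β₁ α₂ β₂ t := by
  rw [← mixedFracResolvent_add_halfLineConv hα₁ hα hβ₁ hβ₂ t ht]
  refine le_add_of_nonneg_right ?_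
  rw [halfLineConv, intervalIntegral.integral_of_le ht.le, integral_Ioc_eq_integral_Ioo]
  refine setIntegral_nonneg measurableSet_Ioo fun s hs => ?_
  exact (mul_pos (mixedFracKernel_pos hα₁ (hα₁.trans_le hα) hβ₁ hβ₂ (sub_pos.2 hs.2))
    (mixedFracResolvent_pos hα₁ hα hα₂ hβ₁ hβ₂ s hs.1)).le

/-- The domination `0 < r ≤ k` reaches every `s > 0`, beyond the range of the Neumann series. The
Tauberian argument needs `s → 0`. -/
theorem laplaceIntegrable_mixedFracResolvent {s : ℝ} (hs : 0 < s) :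
    LaplaceIntegrable s (mixedFracResolvent α₁ β₁ α₂ β₂) := by
  refine (laplaceIntegrable_mixedFracKernel (β₁ := β₁) (β₂ := β₂) hα₁
    (hα₁.trans_le hα) hs).of_le_of_norm_le le_rfl
    ((continuousOn_mixedFracResolvent hα₁ hα hβ₁ hβ₂).aestronglyMeasurable measurableSet_Ioi)
    fun t ht => ?_
  rw [abs_of_pos (mixedFracResolvent_pos hα₁ hα hα₂ hβ₁ hβ₂ t ht)]
  exact mixedFracResolvent_le hα₁ hα hα₂ hβ₁ hβ₂ t ht

theorem laplace_mixedFracResolvent {s : ℝ} (hs : 0 < s) :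
    laplace (mixedFracResolvent α₁ β₁ α₂ β₂) s =
      mixedSymbol α₁ β₁ α₂ β₂ s / (1 + mixedSymbol α₁ β₁ α₂ β₂ s) := by
  have hα₂0 := hα₁.trans_le hα
  have hr := laplaceIntegrable_mixedFracResolvent hα₁ hα hα₂ hβ₁ hβ₂ hs
  have hk := laplaceIntegrable_mixedFracKernel (β₁ := β₁) (β₂ := β₂) hα₁ hα₂0 hs
  have h : laplace (fun t => mixedFracResolvent α₁ β₁ α₂ β₂ t +
      halfLineConv (mixedFracKernel α₁ β₁ α₂ β₂) (mixedFracResolvent α₁ β₁ α₂ β₂) t) s =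
      laplace (mixedFracKernel α₁ β₁ α₂ β₂) s := by
    refine laplace_congr ?_ s
    filter_upwards [ae_restrict_mem measurableSet_Ioi] with t ht
    exact mixedFracResolvent_add_halfLineConv hα₁ hα hβ₁ hβ₂ t ht
  rw [laplace_add hr (hk.halfLineConv hr), laplace_halfLineConv hk hr,
    laplace_mixedFracKernel hα₁ hα₂0 hs] at h
  have hpos := mixedSymbol_pos (α₁ := α₁) (α₂ := α₂) hβ₁ hβ₂ hs
  rw [eq_div_iff (by positivity)]
  linarith

end MixedResolvent

/-! ### Uniqueness of resolvents. -/

section Uniqueness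

theorem tendsto_laplace_atTop {σ : ℝ} {f : ℝ → ℝ} (hf : LaplaceIntegrable σ f) :
    Tendsto (laplace f) atTop (nhds 0) := by
  have h : Tendsto (fun s => ∫ t in Ioi (0 : ℝ), Real.exp (-(s * t)) * f t) atTop
      (nhds (∫ _ in Ioi (0 : ℝ), (0 : ℝ))) := by
    refine tendsto_integral_filter_of_dominated_convergence
      (fun t => ‖Real.exp (-(σ * t)) * f t‖) ?_ ?_ (Integrable.norm hf) ?_
    · filter_upwards [eventually_ge_atTop σ] with s hs
      exact Integrable.aestronglyMeasurable (hf.mono hs)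
    · filter_upwards [eventually_ge_atTop σ] with s hs
      filter_upwards [ae_restrict_mem measurableSet_Ioi] with t ht
      have ht : 0 < t := ht
      rw [norm_mul, norm_mul, Real.norm_of_nonneg (Real.exp_pos _).le,
        Real.norm_of_nonneg (Real.exp_pos _).le]
      gcongr
    · filter_upwards [ae_restrict_mem measurableSet_Ioi] with t ht
      have h1 : Tendsto (fun s : ℝ => Real.exp (-(s * t))) atTop (nhds 0) :=
        Real.tendsto_exp_neg_atTop_nhds_zero.comp (tendsto_id.atTop_mul_const ht)
      simpa using h1.mul_const (f t)
  rw [integral_zero] at h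
  exact h

theorem laplaceIntegrable_indicator_Ioc {R : ℝ → ℝ} (hR : LocallyIntegrableOn R (Ici (0 : ℝ)))
    {s : ℝ} (hs : 0 ≤ s) (T : ℝ) : LaplaceIntegrable s (indicator (Ioc 0 T) R) := by
  have h1 : IntegrableOn R (Ioc 0 T) :=
    (hR.integrableOn_compact_subset Icc_subset_Ici_self isCompact_Icc).mono_set Ioc_subset_Icc_self
  have h2 : IntegrableOn (indicator (Ioc 0 T) R) (Ioi 0) :=
    ((integrable_indicator_iff measurableSet_Ioc).2 h1).integrableOn
  refine Integrable.bdd_mul (c := 1) h2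
    (by fun_prop : Continuous fun t : ℝ => Real.exp (-(s * t))).aestronglyMeasurable ?_
  filter_upwards [ae_restrict_mem measurableSet_Ioi] with t ht
  rw [Real.norm_of_nonneg (Real.exp_pos _).le]
  exact Real.exp_le_one_iff.2 (neg_nonpos.2 (mul_nonneg hs (le_of_lt ht)))

theorem halfLineConv_indicator_Ioc (R φ : ℝ → ℝ) {t T : ℝ} (ht : 0 < t) (htT : t ≤ T) :
    halfLineConv (indicator (Ioc 0 T) R) φ t = halfLineConv R φ t := by
  rw [halfLineConv, halfLineConv, intervalIntegral.integral_of_le ht.le,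
    intervalIntegral.integral_of_le ht.le, integral_Ioc_eq_integral_Ioo,
    integral_Ioc_eq_integral_Ioo]
  refine setIntegral_congr_fun measurableSet_Ioo fun s hs => ?_
  rw [indicator_of_mem (show t - s ∈ Ioc 0 T from ⟨sub_pos.2 hs.2, by linarith [hs.1]⟩)]

/-- Resolvents are unique up to null sets. -/
theorem IsResolventOf.ae_eq {φ R₁ R₂ : ℝ → ℝ} {σ : ℝ} (hφ : LaplaceIntegrable σ φ)
    (h₁ : IsResolventOf φ R₁) (h₂ : IsResolventOf φ R₂) :
    ∀ᵐ t ∂volume.restrict (Ioi (0 : ℝ)), R₁ t = R₂ t := by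
  -- For `s` large the weighted `L¹` norm of `φ` is below `1`, so convolution with `φ` is a
  -- contraction.
  obtain ⟨s, ⟨hθ, hsσ⟩, hs1⟩ := (((tendsto_laplace_atTop hφ.abs).eventually_lt_const
    one_pos).and (eventually_ge_atTop σ)).and (eventually_ge_atTop (0 : ℝ)) |>.exists
  have hφs := hφ.mono hsσ
  -- Resolvents are only locally integrable, so they are truncated at `T`; by causality the equation
  -- on `(0, T]` does not see the truncation.
  have key : ∀ T : ℝ, ∀ᵐ t ∂volume.restrict (Ioi (0 : ℝ)), t ≤ T → R₁ t = R₂ t := by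
    intro T
    have hA₁ := laplaceIntegrable_indicator_Ioc h₁.1 hs1 T
    have hA₂ := laplaceIntegrable_indicator_Ioc h₂.1 hs1 T
    set A₁ := indicator (Ioc 0 T) R₁ with hA₁d
    set A₂ := indicator (Ioc 0 T) R₂ with hA₂d
    set u : ℝ → ℝ := fun t => A₁ t - A₂ t with hu
    have hui : LaplaceIntegrable s u := hA₁.sub hA₂
    -- Linearity of the convolution is obtained almost everywhere from transforms, which avoids
    -- pointwise integrability of the integrands.
    have hlin : ∀ᵐ t ∂volume.restrict (Ioi (0 : ℝ)),
        halfLineConv u φ t = halfLineConv A₁ φ t - halfLineConv A₂ φ t := by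
      refine ae_eq_of_laplace_eq (hui.halfLineConv hφs)
        ((hA₁.halfLineConv hφs).sub (hA₂.halfLineConv hφs)) fun s' hs' => ?_
      rw [laplace_sub ((hA₁.mono hs').halfLineConv (hφs.mono hs'))
          ((hA₂.mono hs').halfLineConv (hφs.mono hs')),
        laplace_halfLineConv (hui.mono hs') (hφs.mono hs'),
        laplace_halfLineConv (hA₁.mono hs') (hφs.mono hs'),
        laplace_halfLineConv (hA₂.mono hs') (hφs.mono hs'),
        laplace_sub (hA₁.mono hs') (hA₂.mono hs'), sub_mul]
    have hmono : volume.restrict (Ioi (0 : ℝ)) ≤ volume.restrict (Ici 0) :=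
      Measure.restrict_mono Ioi_subset_Ici_self le_rfl
    have hle : laplace (fun t => |u t|) s ≤ laplace (fun t => |u t|) s *
        laplace (fun t => |φ t|) s := by
      rw [← laplace_halfLineConv hui.abs hφs.abs]
      refine integral_mono_ae hui.abs (hui.abs.halfLineConv hφs.abs) ?_
      filter_upwards [hlin, h₁.2.filter_mono (ae_mono hmono), h₂.2.filter_mono (ae_mono hmono),
        ae_restrict_mem measurableSet_Ioi] with t e e₁ e₂ ht
      have ht : 0 < t := ht
      refine mul_le_mul_of_nonneg_left ?_ (Real.exp_pos _).le
      have hconv : |halfLineConv u φ t| ≤ halfLineConv (fun t => |u t|) (fun t => |φ t|) t := by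
        rw [halfLineConv, halfLineConv, ← Real.norm_eq_abs]
        simp only [← abs_mul]
        exact intervalIntegral.norm_integral_le_integral_norm ht.le
      by_cases htT : t ≤ T
      · refine le_of_eq_of_le ?_ hconv
        rw [e, halfLineConv_indicator_Ioc R₁ φ ht htT, halfLineConv_indicator_Ioc R₂ φ ht htT]
        have hmem : t ∈ Ioc 0 T := ⟨ht, htT⟩
        simp only [hu, hA₁d, hA₂d, indicator_of_mem hmem]
        rw [e₁, e₂, add_sub_add_left_eq_sub]
      · have hmem : t ∉ Ioc 0 T := fun h => htT h.2
        have hz : u t = 0 := by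
          simp only [hu, hA₁d, hA₂d, indicator_of_notMem hmem, sub_self]
        rw [hz, abs_zero]
        exact (abs_nonneg _).trans hconv
    have hnn : ∀ t, 0 ≤ Real.exp (-(s * t)) * |u t| := fun t =>
      mul_nonneg (Real.exp_pos _).le (abs_nonneg _)
    have hzero : laplace (fun t => |u t|) s = 0 := by
      have h0 : 0 ≤ laplace (fun t => |u t|) s := integral_nonneg hnn
      nlinarith
    have hae := (integral_eq_zero_iff_of_nonneg hnn hui.abs).1 hzero
    filter_upwards [hae, ae_restrict_mem measurableSet_Ioi] with t h0 ht htT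
    have hmem : t ∈ Ioc 0 T := ⟨ht, htT⟩
    simp only [Pi.zero_apply, mul_eq_zero, (Real.exp_pos _).ne', false_or, abs_eq_zero] at h0
    simp only [hu, hA₁d, hA₂d, indicator_of_mem hmem] at h0
    exact sub_eq_zero.1 h0
  have hall := ae_all_iff.2 fun n : ℕ => key n
  filter_upwards [hall] with t ht
  obtain ⟨n, hn⟩ := exists_nat_ge t
  exact ht n hn

end Uniqueness

/-! ### The resolvent of the mixed Mittag-Leffler kernel. -/

section MixedMittagLeffler

variable {α₁ α₂ β₁ β₂ : ℝ}

theorem exists_laplace_mixedMittagLefflerKernel (hα₁ : 0 < α₁) (hα₂ : 0 < α₂) (hβ₁ : 0 < β₁)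
    (hβ₂ : 0 < β₂) : ∃ σ, 0 < σ ∧ ∀ s, σ ≤ s →
      LaplaceIntegrable s (mixedMittagLefflerKernel α₁ β₁ α₂ β₂) ∧
        laplace (mixedMittagLefflerKernel α₁ β₁ α₂ β₂) s =
          β₁ * s ^ (-α₁) / (1 + β₁ * s ^ (-α₁)) * (β₂ * s ^ (-α₂) / (1 + β₂ * s ^ (-α₂))) := by
  obtain ⟨σ, hσ, h⟩ := exists_mixedSymbol_lt_one (β₁ := β₁) (β₂ := β₂) hα₁ hα₂
  refine ⟨σ, hσ, fun s hs => ?_⟩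
  have hs0 := hσ.trans_le hs
  have h1 := h s hs
  rw [mixedSymbol] at h1
  have p1 := mul_pos hβ₁ (Real.rpow_pos_of_pos hs0 (-α₁))
  have p2 := mul_pos hβ₂ (Real.rpow_pos_of_pos hs0 (-α₂))
  obtain ⟨i1, l1⟩ := laplace_mittagLefflerDensity hα₁ hβ₁ hs0 (by linarith)
  obtain ⟨i2, l2⟩ := laplace_mittagLefflerDensity hα₂ hβ₂ hs0 (by linarith)
  exact ⟨i1.halfLineConv i2, by
    rw [mixedMittagLefflerKernel, laplace_halfLineConv i1 i2, l1, l2]⟩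

/-- The resolvent of the mixed Mittag-Leffler kernel. -/
noncomputable def mixedMittagLefflerResolvent (α₁ β₁ α₂ β₂ t : ℝ) : ℝ :=
  β₁ * β₂ * (fracKernel (α₁ + α₂) t -
    halfLineConv (fracKernel (α₁ + α₂)) (mixedFracResolvent α₁ β₁ α₂ β₂) t)

variable (hα₁ : 0 < α₁) (hα : α₁ ≤ α₂) (hα₂ : α₂ < 1) (hβ₁ : 0 < β₁) (hβ₂ : 0 < β₂)
include hα₁ hα hα₂ hβ₁ hβ₂

theorem laplace_mixedMittagLefflerResolvent {s : ℝ} (hs : 0 < s) :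
    LaplaceIntegrable s (mixedMittagLefflerResolvent α₁ β₁ α₂ β₂) ∧
      laplace (mixedMittagLefflerResolvent α₁ β₁ α₂ β₂) s =
        β₁ * s ^ (-α₁) * (β₂ * s ^ (-α₂)) / (1 + mixedSymbol α₁ β₁ α₂ β₂ s) := by
  have hα₂0 := hα₁.trans_le hα
  have hr := laplaceIntegrable_mixedFracResolvent hα₁ hα hα₂ hβ₁ hβ₂ hs
  have hg := laplaceIntegrable_fracKernel (add_pos hα₁ hα₂0) hs
  refine ⟨(hg.sub (hg.halfLineConv hr)).const_mul _, ?_⟩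
  have h := laplace_const_mul (β₁ * β₂) (fun t => fracKernel (α₁ + α₂) t -
    halfLineConv (fracKernel (α₁ + α₂)) (mixedFracResolvent α₁ β₁ α₂ β₂) t) s
  rw [laplace_sub hg (hg.halfLineConv hr), laplace_halfLineConv hg hr,
    laplace_fracKernel (add_pos hα₁ hα₂0) hs,
    laplace_mixedFracResolvent hα₁ hα hα₂ hβ₁ hβ₂ hs, neg_add, Real.rpow_add hs] at h
  have hpos := mixedSymbol_pos (α₁ := α₁) (α₂ := α₂) hβ₁ hβ₂ hs
  refine h.trans ?_
  field_simp
  ring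

/-- In transforms, `R = φ + R * φ` is an identity of rational functions of `x` and `y`, resting on
`(1+x)(1+y) - xy = 1+x+y`. -/
theorem isResolventOf_mixedMittagLefflerResolvent :
    IsResolventOf (mixedMittagLefflerKernel α₁ β₁ α₂ β₂)
      (mixedMittagLefflerResolvent α₁ β₁ α₂ β₂) := by
  obtain ⟨σ, hσ, hφ⟩ := exists_laplace_mixedMittagLefflerKernel hα₁ (hα₁.trans_le hα) hβ₁ hβ₂
  have hR := fun s (hs : σ ≤ s) =>
    laplace_mixedMittagLefflerResolvent hα₁ hα hα₂ hβ₁ hβ₂ (hσ.trans_le hs)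
  refine ⟨(hR σ le_rfl).1.locallyIntegrableOn, ?_⟩
  rw [← restrict_Ioi_eq_restrict_Ici]
  refine ae_eq_of_laplace_eq (hR σ le_rfl).1
    ((hφ σ le_rfl).1.add ((hR σ le_rfl).1.halfLineConv (hφ σ le_rfl).1)) fun s hs => ?_
  have hs0 := hσ.trans_le hs
  rw [laplace_add (hφ s hs).1 ((hR s hs).1.halfLineConv (hφ s hs).1),
    laplace_halfLineConv (hR s hs).1 (hφ s hs).1, (hR s hs).2, (hφ s hs).2, mixedSymbol]
  have p1 := mul_pos hβ₁ (Real.rpow_pos_of_pos hs0 (-α₁))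
  have p2 := mul_pos hβ₂ (Real.rpow_pos_of_pos hs0 (-α₂))
  generalize β₁ * s ^ (-α₁) = x at *
  generalize β₂ * s ^ (-α₂) = y at *
  field_simp
  ring

end MixedMittagLeffler

/-! ### Second-order regular variation from a two-term expansion. -/

section RegularVariation

theorem integral_one_rpow_sub_one {ρ x : ℝ} (hρ : ρ ≠ 0) (hx : 0 < x) :
    ∫ u in (1 : ℝ)..x, u ^ (ρ - 1) = (x ^ ρ - 1) / ρ := by
  rw [integral_rpow (Or.inr ⟨fun h => hρ (by linarith), notMem_uIcc_of_lt one_pos hx⟩)]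
  simp

/-- A power function perturbed by a lower-order power is of second-order regular variation. -/
theorem secondOrderRegVarAtInfinity_of_expansion {p ρ c d : ℝ} {F Q : ℝ → ℝ} (hρ : ρ < 0)
    (hc : 0 < c) (hd : 0 < d) (hmeas : Measurable fun t : Ici (0 : ℝ) => F t)
    (hF : ∀ t, 0 < t → F t = c * (t ^ p - Q t))
    (hQ : Tendsto (fun t => t ^ (-(p + ρ)) * Q t) atTop (nhds d)) :
    SecondOrderRegVarAtInfinity p ρ (fun t => -ρ * d * t ^ ρ) F := by
  set ε : ℝ → ℝ := fun t => t ^ (-p) * Q t with hε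
  have hFε : ∀ t, 0 < t → F t = c * t ^ p * (1 - ε t) := by
    intro t ht
    have h : t ^ p * t ^ (-p) = 1 := by
      rw [← Real.rpow_add ht]
      simp
    rw [hF t ht]
    simp only [hε]
    linear_combination (-c * Q t) * (-h)
  have hεd : Tendsto (fun t => t ^ (-ρ) * ε t) atTop (nhds d) := by
    refine hQ.congr' ?_
    filter_upwards [eventually_gt_atTop 0] with t ht
    rw [neg_add, Real.rpow_add ht]
    simp only [hε]
    ring
  have hε0 : Tendsto ε atTop (nhds 0) := by
    have h := (tendsto_rpow_neg_atTop (neg_pos.2 hρ)).mul hεd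
    rw [zero_mul] at h
    refine h.congr' ?_
    filter_upwards [eventually_gt_atTop 0] with t ht
    rw [← mul_assoc, ← Real.rpow_add ht]
    simp
  have h1 : Tendsto (fun t => 1 - ε t) atTop (nhds 1) := by
    simpa using hε0.const_sub 1
  have hpos : ∀ᶠ t in atTop, 0 < 1 - ε t := h1.eventually_const_lt one_pos
  have hscale : ∀ {x : ℝ}, 0 < x → Tendsto (fun t : ℝ => t * x) atTop atTop := fun hx =>
    tendsto_id.atTop_mul_const hx
  have hratio : ∀ x, 0 < x → ∀ᶠ t in atTop,
      F (t * x) / F t = x ^ p * ((1 - ε (t * x)) / (1 - ε t)) := by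
    intro x hx
    filter_upwards [eventually_gt_atTop 0, hpos] with t ht h0
    rw [hFε t ht, hFε _ (mul_pos ht hx), Real.mul_rpow ht.le hx.le]
    have := Real.rpow_pos_of_pos ht p
    field_simp
  refine ⟨⟨hmeas, Or.inl ?_, fun x hx => ?_⟩, Or.inl ?_, fun x hx => ?_⟩
  · filter_upwards [eventually_gt_atTop 0, hpos] with t ht h0
    rw [hFε t ht]
    exact mul_pos (mul_pos hc (Real.rpow_pos_of_pos ht _)) h0
  · have h := (((h1.comp (hscale hx)).div h1 one_ne_zero).const_mul (x ^ p))
    rw [div_one, mul_one] at h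
    refine h.congr' ?_
    filter_upwards [hratio x hx] with t ht
    exact ht.symm
  · filter_upwards [eventually_gt_atTop 0] with t ht
    exact mul_pos (mul_pos (neg_pos.2 hρ) hd) (Real.rpow_pos_of_pos ht _)
  -- With `F = c t^p (1 - ε)` and `ε ~ d t^ρ`, the deviation of the ratio is `x^p (ε(t) - ε(tx))/(1
  -- - ε(t))`. Dividing by `-ρ d t^ρ` leaves `x^p (x^ρ - 1)/ρ` in the limit.
  · have h := (((hεd.sub ((hεd.comp (hscale hx)).const_mul (x ^ ρ))).div h1 one_ne_zero).mul_const
      (-ρ * d)⁻¹).const_mul (x ^ p)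
    have hval : x ^ p * ((d - x ^ ρ * d) / 1 * (-ρ * d)⁻¹) =
        x ^ p * ∫ u in (1 : ℝ)..x, u ^ (ρ - 1) := by
      rw [integral_one_rpow_sub_one hρ.ne hx]
      have hρ' := hρ.ne
      field_simp
      ring
    rw [hval] at h
    refine h.congr' ?_
    filter_upwards [eventually_gt_atTop 0, hpos, hratio x hx] with t ht h0 hr
    rw [hr]
    simp only [Function.comp_apply, Pi.div_apply]
    have e1 : x ^ ρ * (t * x) ^ (-ρ) = t ^ (-ρ) := by
      rw [Real.mul_rpow ht.le hx.le, mul_left_comm, ← Real.rpow_add hx]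
      simp
    rw [← mul_assoc (x ^ ρ), e1, Real.rpow_neg ht.le]
    have := Real.rpow_pos_of_pos ht ρ
    field_simp
    ring

end RegularVariation

/-! ### The survival function and its tail. -/

section Survival

/-- The solution of `S + (β₁ g_{α₁} + β₂ g_{α₂}) * S = 1`. -/
noncomputable def mixedSurvival (α₁ β₁ α₂ β₂ t : ℝ) : ℝ :=
  1 - integralFromZero (mixedFracResolvent α₁ β₁ α₂ β₂) t

theorem MeasureTheory.LocallyIntegrableOn.continuousOn_integralFromZero {R : ℝ → ℝ}
    (hR : LocallyIntegrableOn R (Ici (0 : ℝ))) : ContinuousOn (integralFromZero R) (Ici 0) := by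
  intro t ht
  have ht : 0 ≤ t := ht
  have h1 : ContinuousOn (integralFromZero R) (Icc 0 (t + 1)) := by
    have h := intervalIntegral.continuousOn_primitive_interval (μ := volume) (f := R)
      (a := 0) (b := t + 1)
    rw [uIcc_of_le (by linarith)] at h
    exact h (hR.integrableOn_compact_subset Icc_subset_Ici_self isCompact_Icc)
  refine (h1 t ⟨ht, by linarith⟩).mono_of_mem_nhdsWithin ?_
  rw [← Ici_inter_Iic]
  exact inter_mem_nhdsWithin _ (Iic_mem_nhds (by linarith))

variable {α₁ α₂ β₁ β₂ : ℝ} (hα₁ : 0 < α₁) (hα : α₁ ≤ α₂) (hα₂ : α₂ < 1)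
  (hβ₁ : 0 < β₁) (hβ₂ : 0 < β₂)
include hα₁ hα hα₂ hβ₁ hβ₂

theorem laplace_mixedSurvival {s : ℝ} (hs : 0 < s) :
    LaplaceIntegrable s (mixedSurvival α₁ β₁ α₂ β₂) ∧
      laplace (mixedSurvival α₁ β₁ α₂ β₂) s = s⁻¹ / (1 + mixedSymbol α₁ β₁ α₂ β₂ s) := by
  have hr := laplaceIntegrable_mixedFracResolvent hα₁ hα hα₂ hβ₁ hβ₂ hs
  have h1 := laplaceIntegrable_one hs
  refine ⟨h1.sub (hr.integralFromZero hs), ?_⟩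
  have h := laplace_sub h1 (hr.integralFromZero hs)
  rw [laplace_one hs, laplace_integralFromZero hr hs,
    laplace_mixedFracResolvent hα₁ hα hα₂ hβ₁ hβ₂ hs] at h
  have hpos := mixedSymbol_pos (α₁ := α₁) (α₂ := α₂) hβ₁ hβ₂ hs
  refine h.trans ?_
  field_simp
  ring

theorem intervalIntegrable_mixedFracResolvent {a b : ℝ} (ha : 0 ≤ a) (hb : 0 ≤ b) :
    IntervalIntegrable (mixedFracResolvent α₁ β₁ α₂ β₂) volume a b := by
  have h := (laplaceIntegrable_mixedFracResolvent hα₁ hα hα₂ hβ₁ hβ₂ one_pos).intervalIntegrable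
  exact (h a ha).symm.trans (h b hb)

theorem antitoneOn_mixedSurvival : AntitoneOn (mixedSurvival α₁ β₁ α₂ β₂) (Ici 0) := by
  intro x hx y hy hxy
  have hi := fun {a b : ℝ} (ha : 0 ≤ a) (hb : 0 ≤ b) =>
    intervalIntegrable_mixedFracResolvent hα₁ hα hα₂ hβ₁ hβ₂ ha hb
  have h := intervalIntegral.integral_add_adjacent_intervals (hi le_rfl hx) (hi hx hy)
  have h0 : 0 ≤ ∫ s in x..y, mixedFracResolvent α₁ β₁ α₂ β₂ s := by
    rw [intervalIntegral.integral_of_le hxy]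
    exact setIntegral_nonneg measurableSet_Ioc fun s hs =>
      (mixedFracResolvent_pos hα₁ hα hα₂ hβ₁ hβ₂ s (lt_of_le_of_lt hx hs.1)).le
  simp only [mixedSurvival, integralFromZero]
  linarith

/-- For every `s > 0`, `e^(-st) ∫₀ᵗ r` is at most the transform of `r`, which is at most `1`; let `s
→ 0`. -/
theorem mixedSurvival_nonneg {t : ℝ} (ht : 0 ≤ t) : 0 ≤ mixedSurvival α₁ β₁ α₂ β₂ t := by
  have hbound : ∀ s, 0 < s →
      integralFromZero (mixedFracResolvent α₁ β₁ α₂ β₂) t ≤ Real.exp (s * t) := by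
    intro s hs
    have hr := laplaceIntegrable_mixedFracResolvent hα₁ hα hα₂ hβ₁ hβ₂ hs
    have hpos := mixedSymbol_pos (α₁ := α₁) (α₂ := α₂) hβ₁ hβ₂ hs
    have hl : laplace (mixedFracResolvent α₁ β₁ α₂ β₂) s ≤ 1 := by
      rw [laplace_mixedFracResolvent hα₁ hα hα₂ hβ₁ hβ₂ hs, div_le_one (by positivity)]
      linarith
    have h1 : Real.exp (-(s * t)) * integralFromZero (mixedFracResolvent α₁ β₁ α₂ β₂) t ≤
        laplace (mixedFracResolvent α₁ β₁ α₂ β₂) s := by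
      rw [integralFromZero, intervalIntegral.integral_of_le ht, ← integral_const_mul]
      calc _ ≤ ∫ u in Ioc 0 t, Real.exp (-(s * u)) * mixedFracResolvent α₁ β₁ α₂ β₂ u := by
            refine setIntegral_mono_on ((hr.integrableOn_Ioc t).const_mul _)
              (hr.mono_set Ioc_subset_Ioi_self) measurableSet_Ioc fun u hu => ?_
            refine mul_le_mul_of_nonneg_right (Real.exp_le_exp.2 ?_)
              (mixedFracResolvent_pos hα₁ hα hα₂ hβ₁ hβ₂ u hu.1).le
            exact neg_le_neg (mul_le_mul_of_nonneg_left hu.2 hs.le)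
        _ ≤ _ := by
            refine setIntegral_mono_set hr ?_ Ioc_subset_Ioi_self.eventuallyLE
            filter_upwards [ae_restrict_mem measurableSet_Ioi] with u hu
            exact mul_nonneg (Real.exp_pos _).le
              (mixedFracResolvent_pos hα₁ hα hα₂ hβ₁ hβ₂ u hu).le
    have h2 := h1.trans hl
    rw [Real.exp_neg, inv_mul_le_iff₀ (Real.exp_pos _), mul_one] at h2
    exact h2
  have hlim : Tendsto (fun s : ℝ => Real.exp (s * t)) (nhdsWithin 0 (Ioi 0)) (nhds 1) := by
    have h : ContinuousAt (fun s : ℝ => Real.exp (s * t)) 0 := by fun_prop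
    have h2 := h.tendsto.mono_left (nhdsWithin_le_nhds (s := Ioi 0))
    simpa using h2
  refine sub_nonneg.2 (ge_of_tendsto hlim ?_)
  filter_upwards [self_mem_nhdsWithin] with s hs
  exact hbound s hs

theorem mixedSurvival_le_one {t : ℝ} (ht : 0 ≤ t) : mixedSurvival α₁ β₁ α₂ β₂ t ≤ 1 := by
  have h := antitoneOn_mixedSurvival hα₁ hα hα₂ hβ₁ hβ₂ (self_mem_Ici) ht ht
  simpa [mixedSurvival, integralFromZero] using h

theorem continuousOn_mixedSurvival : ContinuousOn (mixedSurvival α₁ β₁ α₂ β₂) (Ioi 0) :=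
  continuousOn_const.sub
    ((laplaceIntegrable_mixedFracResolvent hα₁ hα hα₂ hβ₁ hβ₂
      one_pos).locallyIntegrableOn.continuousOn_integralFromZero.mono Ioi_subset_Ici_self)

theorem tendsto_rpow_mul_laplace_mixedSurvival :
    Tendsto (fun s => s ^ (1 - α₂) * laplace (mixedSurvival α₁ β₁ α₂ β₂) s)
      (nhdsWithin 0 (Ioi 0)) (nhds (if α₁ = α₂ then β₁ + β₂ else β₂)⁻¹) := by
  have hα₂0 := hα₁.trans_le hα
  have h1 : Tendsto (fun s : ℝ => s ^ α₂ + β₁ * s ^ (α₂ - α₁) + β₂) (nhdsWithin 0 (Ioi 0))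
      (nhds (0 ^ α₂ + β₁ * 0 ^ (α₂ - α₁) + β₂)) := by
    have c1 := (Real.continuousAt_rpow_const 0 α₂ (Or.inr hα₂0.le)).tendsto
    have c2 := (Real.continuousAt_rpow_const 0 (α₂ - α₁) (Or.inr (by linarith))).tendsto
    exact ((c1.add (c2.const_mul β₁)).add_const β₂).mono_left nhdsWithin_le_nhds
  -- The convention `0 ^ 0 = 1` produces the extra `β₁` exactly when `α₁ = α₂`.
  have hval : (0 : ℝ) ^ α₂ + β₁ * 0 ^ (α₂ - α₁) + β₂ = if α₁ = α₂ then β₁ + β₂ else β₂ := by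
    rw [Real.zero_rpow hα₂0.ne']
    split_ifs with h
    · simp [h]
    · rw [Real.zero_rpow (sub_ne_zero.2 (Ne.symm h))]
      simp
  rw [hval] at h1
  refine (h1.inv₀ ?_).congr' ?_
  · split_ifs <;> positivity
  · filter_upwards [self_mem_nhdsWithin] with s hs
    have hs : 0 < s := hs
    rw [(laplace_mixedSurvival hα₁ hα hα₂ hβ₁ hβ₂ hs).2, mixedSymbol, Real.rpow_sub hs,
      Real.rpow_sub hs, Real.rpow_one, Real.rpow_neg hs.le, Real.rpow_neg hs.le]
    have := Real.rpow_pos_of_pos hs α₁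
    have := Real.rpow_pos_of_pos hs α₂
    field_simp
    ring

theorem tendsto_rpow_mul_mixedSurvival :
    Tendsto (fun t => t ^ α₂ * mixedSurvival α₁ β₁ α₂ β₂ t) atTop
      (nhds ((if α₁ = α₂ then β₁ + β₂ else β₂)⁻¹ / Real.Gamma (1 - α₂))) :=
  tendsto_rpow_mul_of_tendsto_laplace
    ((antitoneOn_mixedSurvival hα₁ hα hα₂ hβ₁ hβ₂).mono Ioi_subset_Ici_self)
    (fun _ ht => mixedSurvival_nonneg hα₁ hα hα₂ hβ₁ hβ₂ ht.le)
    (fun _ hs => (laplace_mixedSurvival hα₁ hα hα₂ hβ₁ hβ₂ hs).1) (hα₁.trans_le hα) hα₂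
    (tendsto_rpow_mul_laplace_mixedSurvival hα₁ hα hα₂ hβ₁ hβ₂)

theorem tendsto_rpow_mul_halfLineConv_mixedSurvival {c : ℝ} (hc : 0 < c) :
    Tendsto (fun t => t ^ (α₂ - c) *
      halfLineConv (fracKernel c) (mixedSurvival α₁ β₁ α₂ β₂) t) atTop
      (nhds ((if α₁ = α₂ then β₁ + β₂ else β₂)⁻¹ / Real.Gamma (c + 1 - α₂))) := by
  have hα₂0 := hα₁.trans_le hα
  have hlim := tendsto_rpow_mul_mixedSurvival hα₁ hα hα₂ hβ₁ hβ₂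
  have h0 := fun {t : ℝ} (ht : 0 < t) => mixedSurvival_nonneg hα₁ hα hα₂ hβ₁ hβ₂ ht.le
  -- Beyond `T` the limit gives the bound; before `T`, `S ≤ 1` does.
  obtain ⟨K, hK⟩ : ∃ K, ∀ t, 0 < t → |t ^ α₂ * mixedSurvival α₁ β₁ α₂ β₂ t| ≤ K := by
    obtain ⟨T, hT⟩ := eventually_atTop.1 (hlim.eventually_le_const (lt_add_one _))
    refine ⟨max (|T| ^ α₂) ((if α₁ = α₂ then β₁ + β₂ else β₂)⁻¹ / Real.Gamma (1 - α₂) + 1), fun t ht => ?_⟩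
    rw [abs_of_nonneg (mul_nonneg (Real.rpow_nonneg ht.le _) (h0 ht))]
    rcases le_total T t with h | h
    · exact le_max_of_le_right (hT t h)
    · refine le_max_of_le_left ?_
      refine (mul_le_of_le_one_right (Real.rpow_nonneg ht.le _)
        (mixedSurvival_le_one hα₁ hα hα₂ hβ₁ hβ₂ ht.le)).trans ?_
      exact Real.rpow_le_rpow ht.le (h.trans (le_abs_self T)) hα₂0.le
  have h := tendsto_rpow_mul_halfLineConv_fracKernel hα₂ hc
    (continuousOn_mixedSurvival hα₁ hα hα₂ hβ₁ hβ₂) hK hlim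
  rwa [div_mul_cancel₀ _ (Real.Gamma_pos_of_pos (by linarith)).ne'] at h

end Survival

/-! ### Exact expansions of the repeated integrals. -/

section Integrals

variable {α₁ α₂ β₁ β₂ : ℝ}

theorem continuousOn_halfLineConv_mixedSurvival (hα₁ : 0 < α₁) (hα : α₁ ≤ α₂) (hα₂ : α₂ < 1)
    (hβ₁ : 0 < β₁) (hβ₂ : 0 < β₂) {c : ℝ} (hc : 0 < c) :
    ContinuousOn (halfLineConv (fracKernel c) (mixedSurvival α₁ β₁ α₂ β₂)) (Ioi 0) := by
  refine continuousOn_halfLineConv hc one_pos (continuousOn_fracKernel c)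
    (continuousOn_mixedSurvival hα₁ hα hα₂ hβ₁ hβ₂)
    (fun T _ => ⟨_, abs_fracKernel_le hc le_rfl⟩) fun T _ => ⟨1, fun t ht => ?_⟩
  rw [sub_self, Real.rpow_zero, mul_one,
    abs_of_nonneg (mixedSurvival_nonneg hα₁ hα hα₂ hβ₁ hβ₂ ht.1.le)]
  exact mixedSurvival_le_one hα₁ hα hα₂ hβ₁ hβ₂ ht.1.le

theorem eqOn_of_laplace_eq {f g : ℝ → ℝ} (hf : ContinuousOn f (Ioi 0))
    (hg : ContinuousOn g (Ioi 0)) (hfi : LaplaceIntegrable 1 f) (hgi : LaplaceIntegrable 1 g)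
    (h : ∀ s, 0 < s → laplace f s = laplace g s) : EqOn f g (Ioi 0) :=
  Measure.eqOn_open_of_ae_eq
    (ae_eq_of_laplace_eq hfi hgi fun s hs => h s (one_pos.trans_le hs)) isOpen_Ioi hf hg

/-- Second-order regular variation of a fractional integral of the resolvent. -/
theorem secondOrderRegVarAtInfinity_of_laplace_eq (hα₁ : 0 < α₁) (hα : α₁ ≤ α₂) (hα₂ : α₂ < 1)
    (hβ₁ : 0 < β₁) (hβ₂ : 0 < β₂) {m : ℝ} (hm : 1 ≤ m) {F : ℝ → ℝ}
    (hmeas : Measurable fun t : Ici (0 : ℝ) => F t) (hF : ContinuousOn F (Ioi 0))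
    (hFi : LaplaceIntegrable 1 F) (hlap : ∀ s, 0 < s → laplace F s =
      s ^ (-m) * laplace (mixedMittagLefflerResolvent α₁ β₁ α₂ β₂) s) :
    SecondOrderRegVarAtInfinity (α₁ + m - 1) (rhoHP α₁ α₂)
      (fun t => -rhoHP α₁ α₂ * (Real.Gamma (α₁ + m) *
        if α₁ = α₂ then ((β₁ + β₂) * Real.Gamma m)⁻¹
        else β₁ / (β₂ * Real.Gamma (2 * α₁ + m - α₂))) * t ^ rhoHP α₁ α₂) F := by
  have hα₂0 := hα₁.trans_le hα
  have hm0 : 0 < m := one_pos.trans_le hm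
  set S := mixedSurvival α₁ β₁ α₂ β₂ with hS
  have hSi := fun {s : ℝ} (hs : 0 < s) => laplace_mixedSurvival hα₁ hα hα₂ hβ₁ hβ₂ hs
  have hSc := fun {c : ℝ} (hc : 0 < c) =>
    continuousOn_halfLineConv_mixedSurvival hα₁ hα hα₂ hβ₁ hβ₂ hc
  have hlim := fun {c : ℝ} (hc : 0 < c) =>
    tendsto_rpow_mul_halfLineConv_mixedSurvival hα₁ hα hα₂ hβ₁ hβ₂ hc
  have hc0 : 0 < α₁ + m := by linarith
  have hc1 : 0 < α₁ + m - 1 := by linarith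
  have hc2 : 0 < 2 * α₁ + m - 1 := by linarith
  have hΓ := Real.Gamma_pos_of_pos hc0
  have hg := fun {s c : ℝ} (hs : 0 < s) (hc : 0 < c) => laplaceIntegrable_fracKernel hc hs
  have hconv := fun {s c : ℝ} (hs : 0 < s) (hc : 0 < c) => (hg hs hc).halfLineConv (hSi hs).1
  have hconvl := fun {s c : ℝ} (hs : 0 < s) (hc : 0 < c) =>
    (laplace_halfLineConv (hg hs hc) (hSi hs).1).trans
      (congrArg₂ (· * ·) (laplace_fracKernel hc hs) (hSi hs).2)
  have hR := fun {s : ℝ} (hs : 0 < s) =>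
    (laplace_mixedMittagLefflerResolvent hα₁ hα hα₂ hβ₁ hβ₂ hs).2
  have hpow1 : ∀ s : ℝ, 0 < s → s ^ (-(α₁ + m)) = s ^ (-α₁) * s ^ (-m) := fun s hs => by
    rw [neg_add, Real.rpow_add hs]
  have hpow2 : ∀ s : ℝ, 0 < s → s ^ (-(α₁ + m - 1)) = s ^ (-α₁) * s ^ (-m) * s := fun s hs => by
    rw [← Real.rpow_add hs, ← Real.rpow_add_one hs.ne']
    ring_nf
  have hpow3 : ∀ s : ℝ, 0 < s →
      s ^ (-(2 * α₁ + m - 1)) = s ^ (-α₁) * s ^ (-α₁) * s ^ (-m) * s := fun s hs => by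
    rw [← Real.rpow_add hs, ← Real.rpow_add hs, ← Real.rpow_add_one hs.ne']
    ring_nf
  by_cases h : α₁ = α₂
  · have hlim1 := hlim hc1
    simp only [rhoHP, if_pos h] at hlim1 ⊢
    -- For equal exponents `x` and `y` are proportional, and only one fractional integral of `S`
    -- occurs. The expansion of the unequal case would leave a correction of the same order as the
    -- leading power.
    set D := fun t => (β₁ + β₂)⁻¹ * (β₁ * β₂) *
      (fracKernel (α₁ + m) t - halfLineConv (fracKernel (α₁ + m - 1)) S t) with hD
    have heq : EqOn F D (Ioi 0) := by
      refine eqOn_of_laplace_eq hF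
        (((continuousOn_fracKernel _).sub (hSc hc1)).const_mul _) hFi
        (((hg one_pos hc0).sub (hconv one_pos hc1)).const_mul _) fun s hs => ?_
      rw [hlap s hs, hR hs, hD, laplace_const_mul, laplace_sub (hg hs hc0) (hconv hs hc1),
        laplace_fracKernel hc0 hs, hconvl hs hc1, hpow1 s hs, hpow2 s hs]
      have hpos := mixedSymbol_pos (α₁ := α₁) (α₂ := α₂) hβ₁ hβ₂ hs
      simp only [mixedSymbol, ← h] at hpos ⊢
      have hx := Real.rpow_pos_of_pos hs (-α₁)
      generalize s ^ (-α₁) = x at *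
      field_simp
      ring
    refine secondOrderRegVarAtInfinity_of_expansion
      (c := (β₁ + β₂)⁻¹ * (β₁ * β₂) / Real.Gamma (α₁ + m))
      (Q := fun t => Real.Gamma (α₁ + m) * halfLineConv (fracKernel (α₁ + m - 1)) S t)
      (by linarith) (by positivity)
      (mul_pos hΓ (inv_pos.2 (mul_pos (by positivity) (Real.Gamma_pos_of_pos hm0)))) hmeas
      (fun t ht => ?_) ?_
    · rw [heq ht, hD]
      simp only [fracKernel]
      field_simp
    · have h2 := hlim1.const_mul (Real.Gamma (α₁ + m))
      have e : α₁ + m - 1 + 1 - α₂ = m := by rw [← h]; ring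
      rw [e, div_eq_mul_inv, ← mul_inv] at h2
      refine h2.congr fun t => ?_
      have e1 : -(α₁ + m - 1 + -α₁) = α₂ - (α₁ + m - 1) := by
        rw [← h]
        ring
      rw [e1]
      ring
  · have hlt : α₁ < α₂ := lt_of_le_of_ne hα h
    have hlim1 := hlim hc1
    have hlim2 := hlim hc2
    simp only [rhoHP, if_neg h] at hlim1 hlim2 ⊢
    -- Inverse transform of `s^(-m) (x - (x² + x)/(1+x+y))`, with `1/(1+x+y)` read as `s` times the
    -- transform of `S`; this `s` explains the `- 1` in the indices.
    set D := fun t => β₁ * (fracKernel (α₁ + m) t -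
      (β₁ * halfLineConv (fracKernel (2 * α₁ + m - 1)) S t +
        halfLineConv (fracKernel (α₁ + m - 1)) S t)) with hD
    have hQi := fun {s : ℝ} (hs : 0 < s) => ((hconv hs hc2).const_mul β₁).add (hconv hs hc1)
    have heq : EqOn F D (Ioi 0) := by
      refine eqOn_of_laplace_eq hF (((continuousOn_fracKernel _).sub
        (((hSc hc2).const_mul β₁).add (hSc hc1))).const_mul _) hFi
        (((hg one_pos hc0).sub (hQi one_pos)).const_mul _) fun s hs => ?_
      rw [hlap s hs, hR hs, hD, laplace_const_mul, laplace_sub (hg hs hc0) (hQi hs),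
        laplace_add ((hconv hs hc2).const_mul β₁) (hconv hs hc1), laplace_const_mul,
        laplace_fracKernel hc0 hs, hconvl hs hc1, hconvl hs hc2, hpow1 s hs, hpow2 s hs,
        hpow3 s hs]
      have hpos := mixedSymbol_pos (α₁ := α₁) (α₂ := α₂) hβ₁ hβ₂ hs
      simp only [mixedSymbol] at hpos ⊢
      generalize s ^ (-α₁) = x at *
      generalize s ^ (-α₂) = y at *
      field_simp
      ring
    have hΓ2 : 0 < Real.Gamma (2 * α₁ + m - α₂) := Real.Gamma_pos_of_pos (by linarith)
    refine secondOrderRegVarAtInfinity_of_expansion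
      (c := β₁ / Real.Gamma (α₁ + m))
      (Q := fun t => Real.Gamma (α₁ + m) * (β₁ * halfLineConv (fracKernel (2 * α₁ + m - 1)) S t +
        halfLineConv (fracKernel (α₁ + m - 1)) S t))
      (by linarith) (by positivity) (by positivity) hmeas (fun t ht => ?_) ?_
    · rw [heq ht, hD]
      simp only [fracKernel]
      field_simp
    -- The second fractional integral is smaller than the first by a factor `t^(-α₁)` and drops out
    -- of the limit.
    · have h3 := (tendsto_rpow_neg_atTop hα₁).mul hlim1
      have h2 := ((hlim2.const_mul β₁).add h3).const_mul (Real.Gamma (α₁ + m))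
      have e : 2 * α₁ + m - 1 + 1 - α₂ = 2 * α₁ + m - α₂ := by ring
      have hval : Real.Gamma (α₁ + m) * (β₁ * (β₂⁻¹ / Real.Gamma (2 * α₁ + m - 1 + 1 - α₂)) +
          0 * (β₂⁻¹ / Real.Gamma (α₁ + m - 1 + 1 - α₂))) =
          Real.Gamma (α₁ + m) * (β₁ / (β₂ * Real.Gamma (2 * α₁ + m - α₂))) := by
        rw [e]
        field_simp
        ring
      rw [hval] at h2
      refine h2.congr' ?_
      filter_upwards [eventually_gt_atTop 0] with t ht
      have e1 : t ^ (-(α₁ + m - 1 + (α₁ - α₂))) = t ^ (α₂ - (2 * α₁ + m - 1)) := by ring_nf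
      have e2 : t ^ (-α₁) * t ^ (α₂ - (α₁ + m - 1)) = t ^ (α₂ - (2 * α₁ + m - 1)) := by
        rw [← Real.rpow_add ht]
        ring_nf
      rw [e1, ← mul_assoc (t ^ (-α₁)), e2]
      ring

end Integrals

/-! ### Conclusion for an arbitrary resolvent. -/

theorem mainTheorem10 (α₁ α₂ β₁ β₂ : ℝ) (hα₁ : 0 < α₁) (hα : α₁ ≤ α₂) (hα₂ : α₂ < 1)
    (hβ₁ : 0 < β₁) (hβ₂ : 0 < β₂) :
    (∃ R : ℝ → ℝ, IsResolventOf (mixedMittagLefflerKernel α₁ β₁ α₂ β₂) R) ∧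
    ∀ R : ℝ → ℝ, IsResolventOf (mixedMittagLefflerKernel α₁ β₁ α₂ β₂) R →
      SecondOrderRegVarAtInfinity α₁ (rhoHP α₁ α₂) (auxHP α₁ β₁ α₂ β₂) (integralFromZero R) ∧
      SecondOrderRegVarAtInfinity (α₁ + 1) (rhoHP α₁ α₂)
        (fun t => (α₁ + 1) / (α₁ + rhoHP α₁ α₂ + 1) * auxHP α₁ β₁ α₂ β₂ t)
        (integralFromZero (integralFromZero R)) := by
  have hα₂0 := hα₁.trans_le hα
  have hres := isResolventOf_mixedMittagLefflerResolvent hα₁ hα hα₂ hβ₁ hβ₂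
  refine ⟨⟨_, hres⟩, fun R hR => ?_⟩
  obtain ⟨σ, hσ, hφ⟩ := exists_laplace_mixedMittagLefflerKernel hα₁ hα₂0 hβ₁ hβ₂
  have hae := hres.ae_eq (hφ σ le_rfl).1 hR
  have hRi : ∀ s, 0 < s → LaplaceIntegrable s R := fun s hs =>
    (laplace_mixedMittagLefflerResolvent hα₁ hα hα₂ hβ₁ hβ₂ hs).1.congr hae
  have hc1 := hR.1.continuousOn_integralFromZero
  have hc2 := (hc1.locallyIntegrableOn measurableSet_Ici
    (μ := volume)).continuousOn_integralFromZero
  have h1 := secondOrderRegVarAtInfinity_of_laplace_eq hα₁ hα hα₂ hβ₁ hβ₂ le_rfl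
    (continuousOn_iff_continuous_domRestrict.1 hc1).measurable (hc1.mono Ioi_subset_Ici_self)
    ((hRi 1 one_pos).integralFromZero one_pos) fun s hs => by
      rw [laplace_integralFromZero (hRi s hs) hs, Real.rpow_neg_one, laplace_congr hae]
  have h2 := secondOrderRegVarAtInfinity_of_laplace_eq hα₁ hα hα₂ hβ₁ hβ₂ one_le_two
    (continuousOn_iff_continuous_domRestrict.1 hc2).measurable (hc2.mono Ioi_subset_Ici_self)
    (((hRi 1 one_pos).integralFromZero one_pos).integralFromZero one_pos) fun s hs => by
      rw [laplace_integralFromZero ((hRi s hs).integralFromZero hs) hs,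
        laplace_integralFromZero (hRi s hs) hs, laplace_congr hae, ← mul_assoc,
        ← Real.rpow_neg_one, ← Real.rpow_add hs]
      norm_num
  constructor
  · convert h1 using 1
    · ring
    · ext t
      rw [auxHP, rhoHP]
      split_ifs with h
      · rw [Real.Gamma_one, add_comm 1 α₁]
        ring
      · have e : 1 + 2 * α₁ - α₂ = 2 * α₁ + 1 - α₂ := by ring
        rw [e, add_comm 1 α₁]
        ring
  · convert h2 using 1
    · ring
    · ext t
      -- Passing from `m = 1` to `m = 2` shifts each Gamma argument by one. The functional equation
      -- gives `α₁ + 1` in the numerator and `α₁ + ρ + 1` in the denominator; the latter is `1` when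
      -- `α₁ = α₂`.
      have hG : Real.Gamma (α₁ + 2) = (α₁ + 1) * Real.Gamma (α₁ + 1) := by
        rw [← Real.Gamma_add_one (by positivity)]
        ring_nf
      rw [auxHP, rhoHP]
      split_ifs with h
      · rw [Real.Gamma_two, add_comm 1 α₁, hG]
        simp only [add_neg_cancel, zero_add, div_one, mul_one]
        ring
      · have e : 1 + 2 * α₁ - α₂ = 2 * α₁ + 1 - α₂ := by ring
        have hpos : 0 < 2 * α₁ + 1 - α₂ := by linarith
        have hG2 : Real.Gamma (2 * α₁ + 2 - α₂) =
            (2 * α₁ + 1 - α₂) * Real.Gamma (2 * α₁ + 1 - α₂) := by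
          rw [← Real.Gamma_add_one hpos.ne']
          ring_nf
        have e2 : α₁ + (α₁ - α₂) + 1 = 2 * α₁ + 1 - α₂ := by ring
        have hΓ := Real.Gamma_pos_of_pos hpos
        rw [e, e2, add_comm 1 α₁, hG, hG2]
        field_simp
        ring
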